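/- \textbf{Definitions.} Let $G$ be a closed subgroup of $GL_n(\mathbb R)$ with a left Haar measure $\mu$. For $\psi\in L^2(\mathbb R^n)$ and $(a,b)\in G\times\mathbb R^n$ put $\psi_{(a,b)}(x)=|\det a|^{-1/2}\,\psi(a^{-1}x-b)$. The function $\psi\in L^2(\mathbb R^n)$ is a \emph{continuous wavelet} for $G$ if every $f\in L^2(\mathbb R^n)$ satisfies the reproducing formula $$f=\int_{G\times\mathbb R^n}\langle f,\psi_{(a,b)}\rangle\,\psi_{(a,b)}\;d\mu(a)\,db$$ in the weak sense, that is, for all $f,g\in L^2(\mathbb R^n)$ the integral $\int_{G\times\mathbb R^n}\langle f,\psi_{(a,b)}\rangle\langle\psi_{(a,b)},g\rangle\,d\mu(a)\,db$ converges absolutely and equals $\langle f,g\rangle$, where $\langle f,g\rangle=\int_{\mathbb R^n} f\,\overline g$. The group $G$ is \emph{admissible} if it has a continuous wavelet; this does not depend on the normalization of $\mu$. \textbf{Theorem.} Let $X$ be a $2\times2$ real matrix, and let $G_X=\{e^{tX}:t\in\mathbb R\}\subset GL_2(\mathbb R)$. Then $G_X$ is admissible if and only if $\operatorname{tr}(X)\neq0$.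 -/

import Mathlib

open MeasureTheory
open scoped ComplexConjugate

noncomputable section

/-- The one-parameter group `G_X = {e^{tX} : t ∈ ℝ}`, as a subgroup of `GL_n(ℝ)`. -/
def oneParameterGroup {n : ℕ} (X : Matrix (Fin n) (Fin n) ℝ) : Subgroup (GL (Fin n) ℝ) where
  carrier := {a | ∃ t : ℝ, (a : Matrix (Fin n) (Fin n) ℝ) = NormedSpace.exp (t • X)}
  one_mem' := ⟨0, by simp⟩
  mul_mem' := by
    rintro a b ⟨s, hs⟩ ⟨t, ht⟩
    refine ⟨s + t, ?_⟩
    rw [Units.val_mul, hs, ht, add_smul, Matrix.exp_add_of_commute]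
    exact ((Commute.refl X).smul_left s).smul_right t
  inv_mem' := by
    rintro a ⟨t, ht⟩
    refine ⟨-t, ?_⟩
    rw [Matrix.coe_units_inv, ht, neg_smul, Matrix.exp_neg]

/-- The inner product `⟨f, g⟩ = ∫ f(x) * conj (g(x)) dx` of `L²(ℝⁿ)`, linear in `f`. -/
def l2Inner {n : ℕ} (f g : EuclideanSpace ℝ (Fin n) → ℂ) : ℂ :=
  ∫ x, f x * conj (g x)

/-- `ψ_{(a,b)}(x) = |det a|^{-1/2} ψ(a⁻¹ x - b)`. -/
def dilateTranslate {n : ℕ} (ψ : EuclideanSpace ℝ (Fin n) → ℂ) (a : GL (Fin n) ℝ)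
    (b : EuclideanSpace ℝ (Fin n)) : EuclideanSpace ℝ (Fin n) → ℂ :=
  fun x => (((√|(a : Matrix (Fin n) (Fin n) ℝ).det|)⁻¹ : ℝ) : ℂ) *
    ψ (Matrix.toEuclideanLin ((a⁻¹ : GL (Fin n) ℝ) : Matrix (Fin n) (Fin n) ℝ) x - b)

/-- `ψ ∈ L²(ℝⁿ)` is a continuous wavelet for the group `G` of dilations with Haar measure `μ`:
every `f ∈ L²(ℝⁿ)` satisfies the reproducing formula
`f = ∫ ⟨f, ψ_{(a,b)}⟩ ψ_{(a,b)} dμ(a) db`.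
The integral of `L²`-valued functions is, as usual, taken in the weak sense: it is tested against
every `g ∈ L²(ℝⁿ)`, and the resulting scalar integrals converge absolutely. -/
def IsContinuousWavelet {n : ℕ} (G : Subgroup (GL (Fin n) ℝ)) [MeasurableSpace G]
    (μ : Measure G) (ψ : EuclideanSpace ℝ (Fin n) → ℂ) : Prop :=
  MemLp ψ 2 volume ∧
    ∀ f g : EuclideanSpace ℝ (Fin n) → ℂ, MemLp f 2 volume → MemLp g 2 volume →
      Integrable (fun p : G × EuclideanSpace ℝ (Fin n) =>
        l2Inner f (dilateTranslate ψ p.1 p.2) * l2Inner (dilateTranslate ψ p.1 p.2) g)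
        (μ.prod volume) ∧
      ∫ p : G × EuclideanSpace ℝ (Fin n),
        l2Inner f (dilateTranslate ψ p.1 p.2) * l2Inner (dilateTranslate ψ p.1 p.2) g
        ∂(μ.prod volume) = l2Inner f g

/-- `G` is admissible: with its subspace topology and a left Haar measure `μ` on its Borel sets,
it has a continuous wavelet. (Multiplying `μ` by `c > 0` and `ψ` by `c^{-1/2}` shows that the
normalization of `μ` is irrelevant.) -/
def IsAdmissible {n : ℕ} (G : Subgroup (GL (Fin n) ℝ)) : Prop :=
  letI : MeasurableSpace G := borel G
  ∃ μ : Measure G, μ.IsHaarMeasure ∧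
    ∃ ψ : EuclideanSpace ℝ (Fin n) → ℂ, IsContinuousWavelet G μ ψ

end

open scoped FourierTransform SchwartzMap InnerProductSpace ContDiff ENNReal

/-! For fixed `a`, the map `b ↦ ⟨f, ψ_{(a,b)}⟩` is, up to the sign of `b` and the factor `|det
a|^{-1/2}`, the Fourier transform of `f̂(a⁻ᵀη) conj ψ̂(η)`. Plancherel in `b` followed by Tonelli
turns the reproducing formula into a pointwise condition on `F = |ψ̂|²`: `F` is integrable and `∫_G
F(aᵀξ) dμ(a) = 1` for almost every `ξ`. Both directions of this equivalence are proved
(`IsContinuousWavelet.exists_lintegral_eq_one`, `exists_isContinuousWavelet`), so the question is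
whether such an `F` exists.

Trace zero: the action preserves Lebesgue measure. For a linear `R` commuting with `G`, evaluating
`∬ F(Rξ) F(aᵀξ)` in two ways gives `∫ F∘R = c ∫ F` with `c` independent of `R`
(`lintegral_comp_eq_of_commute`). The choices `R = 1` and `R = 2` contradict `∫ F(2ξ) dξ = 2⁻ⁿ ∫ F`
unless `∫ F` is `0` or `∞`, and `0` is incompatible with orbit integrals `1`.

Trace `τ ≠ 0`: up to time reversal `τ > 0`, and the flow `S_t ξ = (e^{tX})ᵀ ξ` satisfies `∫ f∘S_t =
e^{-τt} ∫ f`. For a positive integrable `w`, the forward integral `Ψ` of `w` along orbits is then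
finite almost everywhere, and `w e^{-Ψ}` restricted to an orbit is the derivative of a function with
values in `[0,1]`, so its orbit integral `Φ` is finite and positive. Dividing by `Φ` normalizes it
but may destroy integrability. This is repaired by moving along each orbit by a time `κ` with
`e^{-τκ} ≤ Φ`, which leaves orbit integrals unchanged. -/

theorem hasTemperateGrowth_cexp_inner {V : Type*} [NormedAddCommGroup V]
    [InnerProductSpace ℝ V] (b : V) :
    (fun ξ : V => Complex.exp (↑(-2 * Real.pi * ⟪ξ, b⟫_ℝ) * Complex.I)).HasTemperateGrowth := by
  have h : (fun t : ℝ => Complex.exp (Complex.ofRealCLM t *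
      (-(2 * Real.pi * Complex.I)))).HasTemperateGrowth := by
    refine ⟨by fun_prop, fun n => ⟨0, ‖-(2 * (Real.pi : ℂ) * Complex.I)‖ ^ n, fun t => ?_⟩⟩
    have hn : ∀ n : ℕ, iteratedDeriv n
        (fun t : ℝ => Complex.exp (Complex.ofRealCLM t * (-(2 * Real.pi * Complex.I)))) =
        fun t : ℝ => (-(2 * Real.pi * Complex.I)) ^ n *
          Complex.exp (Complex.ofRealCLM t * (-(2 * Real.pi * Complex.I))) := by
      intro n
      induction n with
      | zero => simp
      | succ n ih =>
        rw [iteratedDeriv_succ, ih]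
        ext t
        have h1 : HasDerivAt (fun t : ℝ => Complex.ofRealCLM t * (-(2 * Real.pi * Complex.I)))
            (1 * (-(2 * Real.pi * Complex.I))) t :=
          (Complex.ofRealCLM.hasDerivAt (x := t)).mul_const _
        rw [(h1.cexp.const_mul _).deriv]
        ring
    rw [norm_iteratedFDeriv_eq_norm_iteratedDeriv, hn, norm_mul, norm_pow,
      Complex.norm_exp]
    simp
  have h2 := h.comp (Function.hasTemperateGrowth_inner_left b)
  convert h2 using 1
  ext ξ
  simp only [Function.comp_apply, Complex.ofRealCLM_apply]
  congr 1
  push_cast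
  ring

/-! ### The `L²` Fourier transform for functions, characterized by Schwartz test functions -/

section L2Fourier

variable {V : Type*} [NormedAddCommGroup V] [InnerProductSpace ℝ V] [FiniteDimensional ℝ V]
  [MeasurableSpace V] [BorelSpace V]

/-- The relation "`g` is the Fourier transform of `f`" for square integrable functions. -/
def IsL2Fourier (f g : V → ℂ) : Prop :=
  ∃ (hf : MemLp f 2 (volume : Measure V)) (hg : MemLp g 2 (volume : Measure V)),
    𝓕 (hf.toLp f) = hg.toLp g

theorem MeasureTheory.MemLp.exists_isL2Fourier {f : V → ℂ} (hf : MemLp f 2 (volume : Measure V)) :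
    ∃ g : V → ℂ, Measurable g ∧ IsL2Fourier f g := by
  have h := Lp.memLp (𝓕 (hf.toLp f))
  refine ⟨⇑(𝓕 (hf.toLp f) : Lp (α := V) ℂ 2 volume), (Lp.stronglyMeasurable _).measurable, hf, h, ?_⟩
  simp

theorem MeasureTheory.MemLp.exists_isL2Fourier_eq {g : V → ℂ}
    (hg : MemLp g 2 (volume : Measure V)) :
    ∃ f : V → ℂ, Measurable f ∧ IsL2Fourier f g := by
  have h := Lp.memLp (𝓕⁻ (hg.toLp g))
  refine ⟨⇑(𝓕⁻ (hg.toLp g) : Lp (α := V) ℂ 2 volume), (Lp.stronglyMeasurable _).measurable, h, hg, ?_⟩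
  simp

theorem IsL2Fourier.memLp_left {f g : V → ℂ} (h : IsL2Fourier f g) :
    MemLp f 2 (volume : Measure V) := h.1

theorem IsL2Fourier.memLp_right {f g : V → ℂ} (h : IsL2Fourier f g) :
    MemLp g 2 (volume : Measure V) := h.2.1

theorem inner_toLp_eq_integral {f g : V → ℂ} (hf : MemLp f 2 (volume : Measure V))
    (hg : MemLp g 2 (volume : Measure V)) :
    inner ℂ (hg.toLp g) (hf.toLp f) = ∫ x, f x * conj (g x) := by
  rw [L2.inner_def]
  refine integral_congr_ae ?_
  filter_upwards [hf.coeFn_toLp, hg.coeFn_toLp] with x h1 h2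
  rw [h1, h2]
  rfl

/-- Parseval's identity. -/
theorem IsL2Fourier.integral_mul_conj {f f' g g' : V → ℂ} (hf : IsL2Fourier f f')
    (hg : IsL2Fourier g g') :
    ∫ x, f x * conj (g x) = ∫ x, f' x * conj (g' x) := by
  obtain ⟨hf1, hf2, hf3⟩ := hf
  obtain ⟨hg1, hg2, hg3⟩ := hg
  rw [← inner_toLp_eq_integral hf1 hg1, ← inner_toLp_eq_integral hf2 hg2, ← hf3, ← hg3,
    Lp.inner_fourier_eq]

theorem IsL2Fourier.integral_schwartz_mul {f g : V → ℂ} (h : IsL2Fourier f g) (φ : 𝓢(V, ℂ)) :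
    ∫ x, φ x * g x = ∫ x, 𝓕 φ x * f x := by
  obtain ⟨hf, hg, h⟩ := h
  have h1 := congrArg (fun T : 𝓢'(V, ℂ) => T φ) (Lp.fourier_toTemperedDistribution_eq (hf.toLp f))
  simp only [TemperedDistribution.fourier_apply, Lp.toTemperedDistribution_apply, smul_eq_mul,
    h] at h1
  rw [integral_congr_ae (g := fun x => φ x * (hg.toLp g) x), ← h1]
  · refine integral_congr_ae ?_
    filter_upwards [hf.coeFn_toLp] with x hx
    rw [hx]
  · filter_upwards [hg.coeFn_toLp] with x hx
    rw [hx]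

theorem ae_eq_of_integral_schwartz_mul_eq {f g : V → ℂ}
    (hf : LocallyIntegrable f (volume : Measure V)) (hg : LocallyIntegrable g (volume : Measure V))
    (h : ∀ φ : 𝓢(V, ℂ), ∫ x, φ x * f x = ∫ x, φ x * g x) : f =ᵐ[volume] g := by
  refine ae_eq_of_integral_contDiff_smul_eq hf hg fun φ hφ hc => ?_
  have hg₁ : HasCompactSupport (Complex.ofRealCLM ∘ φ) := hc.comp_left rfl
  have hg₂ : ContDiff ℝ ∞ (Complex.ofRealCLM ∘ φ) := by fun_prop
  simpa using h (hg₁.toSchwartzMap hg₂)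

/-- The genuine `L²` transform of `f` has the same pairings with Schwartz functions as `g`, and
these determine a locally integrable function almost everywhere. Square integrability of `g` is thus
a conclusion, and transformation rules can be checked on test functions. -/
theorem isL2Fourier_of_integral_schwartz_mul {f g : V → ℂ} (hf : MemLp f 2 (volume : Measure V))
    (hg : LocallyIntegrable g (volume : Measure V))
    (h : ∀ φ : 𝓢(V, ℂ), ∫ x, φ x * g x = ∫ x, 𝓕 φ x * f x) : IsL2Fourier f g := by
  obtain ⟨g', -, hg'⟩ := hf.exists_isL2Fourier
  have hae : g' =ᵐ[volume] g := by
    refine ae_eq_of_integral_schwartz_mul_eq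
      (hg'.memLp_right.locallyIntegrable one_le_two) hg fun φ => ?_
    rw [h, hg'.integral_schwartz_mul]
  obtain ⟨h1, h2, h3⟩ := hg'
  have hg2 : MemLp g 2 (volume : Measure V) := (memLp_congr_ae hae).1 h2
  exact ⟨h1, hg2, h3.trans ((MemLp.toLp_eq_toLp_iff h2 hg2).2 hae)⟩

/-- On `L¹ ∩ L²` the `L²` Fourier transform is given by the Fourier integral. -/
theorem isL2Fourier_fourier {f : V → ℂ} (hf1 : Integrable f (volume : Measure V))
    (hf : MemLp f 2 (volume : Measure V)) : IsL2Fourier f (𝓕 f) := by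
  refine isL2Fourier_of_integral_schwartz_mul hf ?_ fun φ => ?_
  · refine Continuous.locallyIntegrable ?_
    exact VectorFourier.fourierIntegral_continuous Real.continuous_fourierChar
      continuous_inner hf1
  · have := VectorFourier.integral_fourierIntegral_smul_eq_flip (μ := (volume : Measure V))
      (ν := (volume : Measure V)) (L := innerₗ V) (f := φ) (g := f)
      Real.continuous_fourierChar continuous_inner φ.integrable hf1
    simp only [smul_eq_mul] at this
    rw [flip_innerₗ] at this
    exact this.symm

theorem IsL2Fourier.const_mul {f g : V → ℂ} (h : IsL2Fourier f g) (c : ℂ) :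
    IsL2Fourier (fun x => c * f x) (fun x => c * g x) := by
  refine isL2Fourier_of_integral_schwartz_mul (h.memLp_left.const_mul c)
    ((h.memLp_right.const_mul c).locallyIntegrable one_le_two) fun φ => ?_
  simp only [mul_left_comm _ c, integral_const_mul, h.integral_schwartz_mul]

theorem IsL2Fourier.comp_sub_right {f g : V → ℂ} (h : IsL2Fourier f g) (b : V) :
    IsL2Fourier (fun x => f (x - b))
      (fun ξ => Complex.exp (↑(-2 * Real.pi * ⟪ξ, b⟫_ℝ) * Complex.I) * g ξ) := by
  have hm := hasTemperateGrowth_cexp_inner b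
  refine isL2Fourier_of_integral_schwartz_mul
    (h.memLp_left.comp_measurePreserving (measurePreserving_sub_right volume b)) ?_ fun φ => ?_
  · refine (MemLp.of_le h.memLp_right (AEStronglyMeasurable.mul ?_
      h.memLp_right.aestronglyMeasurable) ?_).locallyIntegrable one_le_two
    · exact Continuous.aestronglyMeasurable (by fun_prop)
    · exact ae_of_all _ fun x => by
        rw [Pi.mul_apply, norm_mul, Complex.norm_exp_ofReal_mul_I, one_mul]
  -- The character is absorbed into the test function, whose transform is thereby translated by `b`.
  · have key := h.integral_schwartz_mul (SchwartzMap.smulLeftCLM ℂ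
      (fun ξ : V => Complex.exp (↑(-2 * Real.pi * ⟪ξ, b⟫_ℝ) * Complex.I)) φ)
    have h2 : ∀ y, 𝓕 (SchwartzMap.smulLeftCLM ℂ
        (fun ξ : V => Complex.exp (↑(-2 * Real.pi * ⟪ξ, b⟫_ℝ) * Complex.I)) φ) y
        = 𝓕 φ (y + b) := by
      intro y
      rw [SchwartzMap.fourier_coe, SchwartzMap.fourier_coe, Real.fourier_eq', Real.fourier_eq']
      refine integral_congr_ae (ae_of_all _ fun v => ?_)
      beta_reduce
      rw [SchwartzMap.smulLeftCLM_apply_apply hm, smul_eq_mul, smul_eq_mul, smul_eq_mul,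
        ← mul_assoc, ← Complex.exp_add, inner_add_right]
      congr 2
      push_cast
      ring
    simp only [h2, SchwartzMap.smulLeftCLM_apply_apply hm, smul_eq_mul] at key
    have h3 := integral_sub_right_eq_self (μ := (volume : Measure V))
      (fun x => 𝓕 φ (x + b) * f x) b
    simp only [sub_add_cancel] at h3
    rw [h3, ← key]
    congr 1 with x
    ring

/-- Change of variables under an invertible linear map. -/
theorem integral_comp_continuousLinearEquiv (A : V ≃L[ℝ] V) (f : V → ℂ) :
    ∫ x, f (A x) = ((|LinearMap.det (A : V →ₗ[ℝ] V)|⁻¹ : ℝ) : ℂ) * ∫ x, f x := by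
  have h := A.toHomeomorph.measurableEmbedding.integral_map (μ := (volume : Measure V)) f
  have h2 := Measure.map_linearMap_addHaar_eq_smul_addHaar (volume : Measure V)
    (f := (A : V →ₗ[ℝ] V)) (LinearEquiv.isUnit_det' A.toLinearEquiv).ne_zero
  have h3 : Measure.map A.toHomeomorph (volume : Measure V)
    = Measure.map (A : V →ₗ[ℝ] V) volume := rfl
  rw [h3, h2, integral_smul_measure, ENNReal.toReal_ofReal (abs_nonneg _)] at h
  rw [abs_inv] at h
  simpa using h.symm

theorem lintegral_comp_continuousLinearEquiv (A : V ≃L[ℝ] V) (f : V → ℝ≥0∞) :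
    ∫⁻ x, f (A x) = ENNReal.ofReal |LinearMap.det (A : V →ₗ[ℝ] V)|⁻¹ * ∫⁻ x, f x := by
  have h := A.toHomeomorph.measurableEmbedding.lintegral_map (μ := (volume : Measure V)) f
  have h2 := Measure.map_linearMap_addHaar_eq_smul_addHaar (volume : Measure V)
    (f := (A : V →ₗ[ℝ] V)) (LinearEquiv.isUnit_det' A.toLinearEquiv).ne_zero
  have h3 : Measure.map A.toHomeomorph (volume : Measure V)
    = Measure.map (A : V →ₗ[ℝ] V) volume := rfl
  rw [h3, h2, lintegral_smul_measure, abs_inv] at h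
  simpa using h.symm

theorem quasiMeasurePreserving_continuousLinearEquiv (A : V ≃L[ℝ] V) :
    Measure.QuasiMeasurePreserving A (volume : Measure V) volume := by
  refine ⟨A.continuous.measurable, ?_⟩
  have h2 := Measure.map_linearMap_addHaar_eq_smul_addHaar (volume : Measure V)
    (f := (A : V →ₗ[ℝ] V)) (LinearEquiv.isUnit_det' A.toLinearEquiv).ne_zero
  have h3 : Measure.map A (volume : Measure V) = Measure.map (A : V →ₗ[ℝ] V) volume := rfl
  rw [h3, h2]
  exact Measure.smul_absolutelyContinuous

theorem memLp_two_iff_lintegral {α : Type*} [MeasurableSpace α] {μ : Measure α} {f : α → ℂ}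
    (hf : AEStronglyMeasurable f μ) :
    MemLp f 2 μ ↔ ∫⁻ x, ‖f x‖ₑ ^ 2 ∂μ < ⊤ := by
  rw [MemLp, eLpNorm_lt_top_iff_lintegral_rpow_enorm_lt_top (by simp) (by simp)]
  simp [hf]

theorem MeasureTheory.MemLp.comp_continuousLinearEquiv {f : V → ℂ}
    (hf : MemLp f 2 (volume : Measure V)) (A : V ≃L[ℝ] V) : MemLp (fun x => f (A x)) 2 volume := by
  have hm : AEStronglyMeasurable (fun x => f (A x)) volume :=
    hf.aestronglyMeasurable.comp_quasiMeasurePreserving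
      (quasiMeasurePreserving_continuousLinearEquiv A)
  rw [memLp_two_iff_lintegral hm, lintegral_comp_continuousLinearEquiv A (fun x => ‖f x‖ₑ ^ 2)]
  exact ENNReal.mul_lt_top ENNReal.ofReal_lt_top ((memLp_two_iff_lintegral hf.aestronglyMeasurable).1 hf)

/-- If `B` is the adjoint of `A`, then composing with `A⁻¹` corresponds to composing the Fourier
transform with `B`. -/
theorem IsL2Fourier.comp_symm {f g : V → ℂ} (h : IsL2Fourier f g) (A B : V ≃L[ℝ] V)
    (hAB : ∀ x y, ⟪A x, y⟫_ℝ = ⟪x, B y⟫_ℝ)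
    (hdet : LinearMap.det (B : V →ₗ[ℝ] V) = LinearMap.det (A : V →ₗ[ℝ] V)) :
    IsL2Fourier (fun x => f (A.symm x))
      (fun ξ => ((|LinearMap.det (A : V →ₗ[ℝ] V)| : ℝ) : ℂ) * g (B ξ)) := by
  set d := |LinearMap.det (A : V →ₗ[ℝ] V)| with hd
  have hd0 : d ≠ 0 := abs_ne_zero.2 (LinearEquiv.isUnit_det' A.toLinearEquiv).ne_zero
  refine isL2Fourier_of_integral_schwartz_mul (h.memLp_left.comp_continuousLinearEquiv A.symm)
    (((h.memLp_right.comp_continuousLinearEquiv B).const_mul _).locallyIntegrable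
      one_le_two) fun φ => ?_
  -- Testing against `φ ∘ B⁻¹` works because its transform is `|det A| (𝓕 φ) ∘ A`, by adjointness.
  have key := h.integral_schwartz_mul (SchwartzMap.compCLMOfContinuousLinearEquiv ℂ B.symm φ)
  have h2 : ∀ y, 𝓕 (SchwartzMap.compCLMOfContinuousLinearEquiv ℂ B.symm φ) y
      = d * 𝓕 φ (A y) := by
    intro y
    rw [SchwartzMap.fourier_coe, SchwartzMap.fourier_coe, Real.fourier_eq, Real.fourier_eq]
    have := integral_comp_continuousLinearEquiv B
      (fun v => 𝐞 (-⟪v, y⟫_ℝ) • (SchwartzMap.compCLMOfContinuousLinearEquiv ℂ B.symm φ) v)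
    rw [hdet, ← hd] at this
    rw [← mul_right_inj' (a := ((d⁻¹ : ℝ) : ℂ)) (by simpa using hd0), ← this]
    rw [← mul_assoc, ← Complex.ofReal_mul, inv_mul_cancel₀ hd0, Complex.ofReal_one, one_mul]
    refine integral_congr_ae (ae_of_all _ fun v => ?_)
    simp only [SchwartzMap.compCLMOfContinuousLinearEquiv_apply, Function.comp_apply,
      ContinuousLinearEquiv.symm_apply_apply]
    rw [real_inner_comm, ← hAB, real_inner_comm]
  simp only [h2, SchwartzMap.compCLMOfContinuousLinearEquiv_apply, Function.comp_apply] at key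
  have e1 := integral_comp_continuousLinearEquiv B (fun ξ => φ (B.symm ξ) * g ξ)
  have e2 := integral_comp_continuousLinearEquiv A (fun x => 𝓕 φ x * f (A.symm x))
  simp only [ContinuousLinearEquiv.symm_apply_apply] at e1 e2
  rw [hdet, ← hd] at e1
  rw [← hd] at e2
  simp only [mul_left_comm _ (d : ℂ), integral_const_mul, e1, key]
  simp only [mul_assoc, integral_const_mul, e2]
  have hdc : (d : ℂ) ≠ 0 := by exact_mod_cast hd0
  push_cast
  field_simp

end L2Fourier

theorem IsL2Fourier.lintegral_enorm_sq {V : Type*} [NormedAddCommGroup V] [InnerProductSpace ℝ V]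
    [FiniteDimensional ℝ V] [MeasurableSpace V] [BorelSpace V] {f g : V → ℂ}
    (h : IsL2Fourier f g) : ∫⁻ x, ‖f x‖ₑ ^ 2 = ∫⁻ x, ‖g x‖ₑ ^ 2 := by
  obtain ⟨hf, hg, h⟩ := h
  have h1 := Lp.norm_fourier_eq (hf.toLp f)
  rw [h] at h1
  have h2 : eLpNorm f 2 volume = eLpNorm g 2 volume := by
    rw [← Lp.enorm_toLp hf, ← Lp.enorm_toLp hg, enorm_eq_iff_norm_eq]
    exact h1.symm
  have h3 := fun f : V → ℂ => eLpNorm_nnreal_pow_eq_lintegral (μ := (volume : Measure V)) (f := f)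
    (p := 2) (by simp)
  simp only [ENNReal.coe_ofNat, NNReal.coe_ofNat, ENNReal.rpow_ofNat] at h3
  rw [← h3, ← h3, h2]

theorem continuous_fourier_of_integrable {V : Type*} [NormedAddCommGroup V]
    [InnerProductSpace ℝ V] [FiniteDimensional ℝ V] [MeasurableSpace V] [BorelSpace V] {f : V → ℂ}
    (hf : Integrable f (volume : Measure V)) : Continuous (𝓕 f) :=
  VectorFourier.fourierIntegral_continuous Real.continuous_fourierChar continuous_inner hf

theorem MeasureTheory.MemLp.complex_conj {α : Type*} [MeasurableSpace α] {μ : Measure α}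
    {p : ℝ≥0∞} {f : α → ℂ} (hf : MemLp f p μ) : MemLp (fun x => conj (f x)) p μ :=
  MemLp.of_le hf (Complex.continuous_conj.comp_aestronglyMeasurable hf.aestronglyMeasurable)
    (ae_of_all _ fun x => by simp)

theorem l2Inner_swap {n : ℕ} (f g : EuclideanSpace ℝ (Fin n) → ℂ) :
    l2Inner g f = conj (l2Inner f g) := by
  rw [l2Inner, l2Inner, ← integral_conj]
  simp [mul_comm]

/-! ### Action of invertible matrices and their transposes on Euclidean space -/

namespace Matrix.GeneralLinearGroup

variable {n : ℕ}

/-- The action of an invertible matrix on Euclidean space. -/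
noncomputable def euclideanEquiv (a : GL (Fin n) ℝ) :
    EuclideanSpace ℝ (Fin n) ≃L[ℝ] EuclideanSpace ℝ (Fin n) :=
  ContinuousLinearEquiv.equivOfInverse (toEuclideanCLM (𝕜 := ℝ) (a : Matrix (Fin n) (Fin n) ℝ))
    (toEuclideanCLM (𝕜 := ℝ) ((a⁻¹ : GL (Fin n) ℝ) : Matrix (Fin n) (Fin n) ℝ))
    (fun x => by rw [← mul_apply_eq_comp, ← map_mul, Units.inv_mul]; simp)
    (fun x => by rw [← mul_apply_eq_comp, ← map_mul, Units.mul_inv]; simp)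

/-- The action of the transpose of an invertible matrix on Euclidean space. -/
noncomputable def transposeEquiv (a : GL (Fin n) ℝ) :
    EuclideanSpace ℝ (Fin n) ≃L[ℝ] EuclideanSpace ℝ (Fin n) :=
  ContinuousLinearEquiv.equivOfInverse (toEuclideanCLM (𝕜 := ℝ) (a : Matrix (Fin n) (Fin n) ℝ)ᵀ)
    (toEuclideanCLM (𝕜 := ℝ) ((a⁻¹ : GL (Fin n) ℝ) : Matrix (Fin n) (Fin n) ℝ)ᵀ)
    (fun x => by
      rw [← mul_apply_eq_comp, ← map_mul, ← transpose_mul, Units.mul_inv]; simp)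
    (fun x => by
      rw [← mul_apply_eq_comp, ← map_mul, ← transpose_mul, Units.inv_mul]; simp)

theorem transposeEquiv_apply (a : GL (Fin n) ℝ) (x : EuclideanSpace ℝ (Fin n)) :
    transposeEquiv a x = toEuclideanCLM (𝕜 := ℝ) (a : Matrix (Fin n) (Fin n) ℝ)ᵀ x := rfl

theorem transposeEquiv_mul (a b : GL (Fin n) ℝ) (x : EuclideanSpace ℝ (Fin n)) :
    transposeEquiv (a * b) x = transposeEquiv b (transposeEquiv a x) := by
  simp only [transposeEquiv_apply]
  rw [← mul_apply_eq_comp, ← map_mul, ← transpose_mul]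
  rfl

theorem transposeEquiv_symm (a : GL (Fin n) ℝ) :
    (transposeEquiv a).symm = transposeEquiv a⁻¹ := by
  ext x
  rfl

theorem inner_euclideanEquiv (a : GL (Fin n) ℝ) (x y : EuclideanSpace ℝ (Fin n)) :
    ⟪euclideanEquiv a x, y⟫_ℝ = ⟪x, transposeEquiv a y⟫_ℝ := by
  rw [transposeEquiv_apply, real_inner_comm]
  change ⟪y, toEuclideanCLM (𝕜 := ℝ) (a : Matrix (Fin n) (Fin n) ℝ) x⟫_ℝ = _
  rw [inner_toEuclideanCLM, inner_toEuclideanCLM, dotProduct_mulVec, dotProduct_comm,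
    ← mulVec_transpose]

theorem det_toEuclideanCLM (M : Matrix (Fin n) (Fin n) ℝ) :
    LinearMap.det (toEuclideanCLM (𝕜 := ℝ) M : EuclideanSpace ℝ (Fin n) →ₗ[ℝ] _) = M.det := by
  rw [coe_toEuclideanCLM_eq_toEuclideanLin, toEuclideanLin_eq_toLin_orthonormal, LinearMap.det_toLin]

theorem det_euclideanEquiv (a : GL (Fin n) ℝ) :
    LinearMap.det (euclideanEquiv a : EuclideanSpace ℝ (Fin n) →ₗ[ℝ] _) =
      (a : Matrix (Fin n) (Fin n) ℝ).det :=
  det_toEuclideanCLM _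

theorem det_transposeEquiv (a : GL (Fin n) ℝ) :
    LinearMap.det (transposeEquiv a : EuclideanSpace ℝ (Fin n) →ₗ[ℝ] _) =
      (a : Matrix (Fin n) (Fin n) ℝ).det :=
  (det_toEuclideanCLM _).trans (det_transpose _)

theorem abs_det_pos (a : GL (Fin n) ℝ) : 0 < |(a : Matrix (Fin n) (Fin n) ℝ).det| :=
  abs_pos.2 ((isUnit_iff_isUnit_det _).1 a.isUnit).ne_zero

theorem continuous_transposeEquiv :
    Continuous fun p : GL (Fin n) ℝ × EuclideanSpace ℝ (Fin n) => transposeEquiv p.1 p.2 := by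
  have h : ∀ p : GL (Fin n) ℝ × EuclideanSpace ℝ (Fin n), transposeEquiv p.1 p.2 =
      WithLp.toLp 2 ((p.1 : Matrix (Fin n) (Fin n) ℝ)ᵀ *ᵥ WithLp.ofLp p.2) := fun p => rfl
  simp only [h]
  have h1 : Continuous fun p : GL (Fin n) ℝ × EuclideanSpace ℝ (Fin n) =>
      (p.1 : Matrix (Fin n) (Fin n) ℝ) := Units.continuous_val.comp continuous_fst
  refine (PiLp.continuous_toLp 2 _).comp (Continuous.matrix_mulVec h1.matrix_transpose ?_)
  exact (PiLp.continuous_ofLp 2 _).comp continuous_snd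

theorem continuous_euclideanEquiv_symm :
    Continuous fun p : GL (Fin n) ℝ × EuclideanSpace ℝ (Fin n) =>
      (euclideanEquiv p.1).symm p.2 := by
  have h : ∀ p : GL (Fin n) ℝ × EuclideanSpace ℝ (Fin n), (euclideanEquiv p.1).symm p.2 =
      WithLp.toLp 2 (((p.1⁻¹ : GL (Fin n) ℝ) : Matrix (Fin n) (Fin n) ℝ) *ᵥ
        WithLp.ofLp p.2) := fun p => rfl
  simp only [h]
  have h1 : Continuous fun p : GL (Fin n) ℝ × EuclideanSpace ℝ (Fin n) =>
      ((p.1⁻¹ : GL (Fin n) ℝ) : Matrix (Fin n) (Fin n) ℝ) :=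
    Units.continuous_val.comp (continuous_inv.comp continuous_fst)
  refine (PiLp.continuous_toLp 2 _).comp (Continuous.matrix_mulVec h1 ?_)
  exact (PiLp.continuous_ofLp 2 _).comp continuous_snd

theorem secondCountableTopology : SecondCountableTopology (GL (Fin n) ℝ) := by
  have : SecondCountableTopology (Matrix (Fin n) (Fin n) ℝ) :=
    inferInstanceAs (SecondCountableTopology (Fin n → Fin n → ℝ))
  have : SecondCountableTopology (Matrix (Fin n) (Fin n) ℝ)ᵐᵒᵖ :=
    MulOpposite.opHomeomorph.symm.isEmbedding.secondCountableTopology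
  exact Units.isEmbedding_embedProduct.secondCountableTopology

theorem secondCountableTopology_subgroup (G : Subgroup (GL (Fin n) ℝ)) :
    SecondCountableTopology G :=
  have := secondCountableTopology (n := n)
  TopologicalSpace.Subtype.secondCountableTopology (G : Set (GL (Fin n) ℝ))

attribute [irreducible] transposeEquiv

end Matrix.GeneralLinearGroup

/-! ### The wavelet transform at a fixed scale -/

section WaveletTransform

open Matrix.GeneralLinearGroup

variable {n : ℕ}

theorem IsL2Fourier.dilateTranslate_transpose {ψ ψ' : EuclideanSpace ℝ (Fin n) → ℂ} (h : IsL2Fourier ψ ψ')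
    (a : GL (Fin n) ℝ) (b : EuclideanSpace ℝ (Fin n)) :
    IsL2Fourier (dilateTranslate ψ a b) (fun ξ => ((√|(a : Matrix (Fin n) (Fin n) ℝ).det| : ℝ) : ℂ) *
      (Complex.exp (↑(-2 * Real.pi * ⟪transposeEquiv a ξ, b⟫_ℝ) * Complex.I) *
        ψ' (transposeEquiv a ξ))) := by
  have h1 := ((h.comp_sub_right b).comp_symm (euclideanEquiv a) (transposeEquiv a)
    (inner_euclideanEquiv a) ((det_transposeEquiv a).trans (det_euclideanEquiv a).symm)).const_mul
    (((√|(a : Matrix (Fin n) (Fin n) ℝ).det|)⁻¹ : ℝ) : ℂ)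
  rw [det_euclideanEquiv] at h1
  have h0 : dilateTranslate ψ a b = fun x =>
      (((√|(a : Matrix (Fin n) (Fin n) ℝ).det|)⁻¹ : ℝ) : ℂ) *
        ψ ((euclideanEquiv a).symm x - b) := rfl
  rw [h0]
  convert h1 using 1
  ext ξ
  rw [← mul_assoc _ ((|(a : Matrix (Fin n) (Fin n) ℝ).det| : ℝ) : ℂ), ← Complex.ofReal_mul]
  congr 2
  have h2 := Real.sqrt_pos.2 (abs_det_pos a)
  have h3 := Real.mul_self_sqrt (abs_det_pos a).le
  field_simp
  nlinarith

/-- The function whose Fourier transform is the wavelet transform at scale `a`. -/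
noncomputable def waveletSymbol (f' ψ' : EuclideanSpace ℝ (Fin n) → ℂ) (a : GL (Fin n) ℝ) :
    EuclideanSpace ℝ (Fin n) → ℂ :=
  fun η => f' ((transposeEquiv a).symm η) * conj (ψ' η)

theorem integrable_waveletSymbol {f' ψ' : EuclideanSpace ℝ (Fin n) → ℂ}
    (hf : MemLp f' 2 volume) (hψ : MemLp ψ' 2 volume) (a : GL (Fin n) ℝ) :
    Integrable (waveletSymbol f' ψ' a) volume :=
  (hf.comp_continuousLinearEquiv (transposeEquiv a).symm).integrable_mul hψ.complex_conj

/-- Parseval, followed by the substitution `η = aᵀξ`. The symbol is a product of two `L²` functions,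
hence integrable, so the Fourier integral makes sense at every `b`. -/
theorem l2Inner_dilateTranslate {f f' ψ ψ' : EuclideanSpace ℝ (Fin n) → ℂ}
    (hf : IsL2Fourier f f') (hψ : IsL2Fourier ψ ψ') (a : GL (Fin n) ℝ)
    (b : EuclideanSpace ℝ (Fin n)) :
    l2Inner f (dilateTranslate ψ a b) =
      (((√|(a : Matrix (Fin n) (Fin n) ℝ).det|)⁻¹ : ℝ) : ℂ) * 𝓕 (waveletSymbol f' ψ' a) (-b) := by
  rw [l2Inner, hf.integral_mul_conj (hψ.dilateTranslate_transpose a b)]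
  have h1 := integral_comp_continuousLinearEquiv (transposeEquiv a) (fun η =>
    f' ((transposeEquiv a).symm η) * conj (((√|(a : Matrix (Fin n) (Fin n) ℝ).det| : ℝ) : ℂ) *
      (Complex.exp (↑(-2 * Real.pi * ⟪η, b⟫_ℝ) * Complex.I) * ψ' η)))
  simp only [ContinuousLinearEquiv.symm_apply_apply, det_transposeEquiv] at h1
  rw [h1, Real.fourier_eq', ← integral_const_mul, ← integral_const_mul]
  congr 1 with η
  simp only [waveletSymbol, map_mul, Complex.conj_ofReal, ← Complex.exp_conj, Complex.conj_I,
    smul_eq_mul, inner_neg_right]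
  have e : ((|(a : Matrix (Fin n) (Fin n) ℝ).det|⁻¹ : ℝ) : ℂ) *
      ((√|(a : Matrix (Fin n) (Fin n) ℝ).det| : ℝ) : ℂ) =
      (((√|(a : Matrix (Fin n) (Fin n) ℝ).det|)⁻¹ : ℝ) : ℂ) := by
    rw [← Complex.ofReal_mul]
    congr 1
    have h2 := Real.sqrt_pos.2 (abs_det_pos a)
    have h3 := Real.mul_self_sqrt (abs_det_pos a).le
    have h4 := abs_det_pos a
    field_simp
    nlinarith
  rw [← e]
  have e2 : (((-2 * Real.pi * ⟪η, b⟫_ℝ : ℝ) : ℂ) * -Complex.I) =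
      (((-2 * Real.pi * -⟪η, b⟫_ℝ : ℝ) : ℂ) * Complex.I) := by
    push_cast
    ring
  rw [e2]
  ring

theorem lintegral_enorm_waveletSymbol (f' ψ' : EuclideanSpace ℝ (Fin n) → ℂ) (a : GL (Fin n) ℝ) :
    ENNReal.ofReal |(a : Matrix (Fin n) (Fin n) ℝ).det|⁻¹ * ∫⁻ η, ‖waveletSymbol f' ψ' a η‖ₑ ^ 2 =
      ∫⁻ ξ, ‖f' ξ‖ₑ ^ 2 * ‖ψ' (transposeEquiv a ξ)‖ₑ ^ 2 := by
  have h1 := lintegral_comp_continuousLinearEquiv (transposeEquiv a)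
    (fun η => ‖waveletSymbol f' ψ' a η‖ₑ ^ 2)
  rw [det_transposeEquiv] at h1
  rw [← h1]
  simp [waveletSymbol, mul_pow]

theorem memLp_waveletSymbol {f' ψ' : EuclideanSpace ℝ (Fin n) → ℂ}
    (hf : MemLp f' 2 volume) (hψ : MemLp ψ' 2 volume) (a : GL (Fin n) ℝ)
    (hfin : ∫⁻ ξ, ‖f' ξ‖ₑ ^ 2 * ‖ψ' (transposeEquiv a ξ)‖ₑ ^ 2 ≠ ⊤) :
    MemLp (waveletSymbol f' ψ' a) 2 volume := by
  rw [memLp_two_iff_lintegral (integrable_waveletSymbol hf hψ a).aestronglyMeasurable]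
  rw [← lintegral_enorm_waveletSymbol] at hfin
  by_contra h
  rw [not_lt_top_iff] at h
  rw [h, ENNReal.mul_top] at hfin
  · exact hfin rfl
  · simpa using (abs_det_pos a)

/-- Plancherel's theorem for the wavelet transform at a fixed scale. -/
theorem lintegral_enorm_l2Inner_dilateTranslate {f f' ψ ψ' : EuclideanSpace ℝ (Fin n) → ℂ}
    (hf : IsL2Fourier f f') (hψ : IsL2Fourier ψ ψ') (a : GL (Fin n) ℝ)
    (hfin : ∫⁻ ξ, ‖f' ξ‖ₑ ^ 2 * ‖ψ' (transposeEquiv a ξ)‖ₑ ^ 2 ≠ ⊤) :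
    ∫⁻ b, ‖l2Inner f (dilateTranslate ψ a b)‖ₑ ^ 2 =
      ∫⁻ ξ, ‖f' ξ‖ₑ ^ 2 * ‖ψ' (transposeEquiv a ξ)‖ₑ ^ 2 := by
  have h := isL2Fourier_fourier (integrable_waveletSymbol hf.memLp_right hψ.memLp_right a)
    (memLp_waveletSymbol hf.memLp_right hψ.memLp_right a hfin)
  simp only [l2Inner_dilateTranslate hf hψ, enorm_mul, mul_pow]
  rw [lintegral_const_mul' _ _ (by simp)]
  rw [lintegral_neg_eq_self (fun b => ‖𝓕 (waveletSymbol f' ψ' a) b‖ₑ ^ 2),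
    ← h.lintegral_enorm_sq, ← lintegral_enorm_waveletSymbol]
  congr 1
  have h2 := Real.sqrt_pos.2 (abs_det_pos a)
  rw [← ofReal_norm, Complex.norm_real, Real.norm_of_nonneg (by positivity),
    ← ENNReal.ofReal_pow (by positivity), inv_pow, Real.sq_sqrt (abs_nonneg _)]

/-- Parseval's identity for the wavelet transform at a fixed scale. -/
theorem integral_l2Inner_dilateTranslate_mul_conj
    {f f' g g' ψ ψ' : EuclideanSpace ℝ (Fin n) → ℂ}
    (hf : IsL2Fourier f f') (hg : IsL2Fourier g g') (hψ : IsL2Fourier ψ ψ') (a : GL (Fin n) ℝ)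
    (hfin : ∫⁻ ξ, ‖f' ξ‖ₑ ^ 2 * ‖ψ' (transposeEquiv a ξ)‖ₑ ^ 2 ≠ ⊤)
    (hgin : ∫⁻ ξ, ‖g' ξ‖ₑ ^ 2 * ‖ψ' (transposeEquiv a ξ)‖ₑ ^ 2 ≠ ⊤) :
    ∫ b, l2Inner f (dilateTranslate ψ a b) * conj (l2Inner g (dilateTranslate ψ a b)) =
      ∫ ξ, f' ξ * conj (g' ξ) * ((‖ψ' (transposeEquiv a ξ)‖ ^ 2 : ℝ) : ℂ) := by
  have h1 := isL2Fourier_fourier (integrable_waveletSymbol hf.memLp_right hψ.memLp_right a)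
    (memLp_waveletSymbol hf.memLp_right hψ.memLp_right a hfin)
  have h2 := isL2Fourier_fourier (integrable_waveletSymbol hg.memLp_right hψ.memLp_right a)
    (memLp_waveletSymbol hg.memLp_right hψ.memLp_right a hgin)
  simp only [l2Inner_dilateTranslate hf hψ, l2Inner_dilateTranslate hg hψ, map_mul,
    Complex.conj_ofReal]
  have e : ∀ x y : ℂ, (((√|(a : Matrix (Fin n) (Fin n) ℝ).det|)⁻¹ : ℝ) : ℂ) * x *
      ((((√|(a : Matrix (Fin n) (Fin n) ℝ).det|)⁻¹ : ℝ) : ℂ) * y) =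
      ((|(a : Matrix (Fin n) (Fin n) ℝ).det|⁻¹ : ℝ) : ℂ) * (x * y) := by
    intro x y
    rw [mul_mul_mul_comm, ← Complex.ofReal_mul, ← mul_inv, Real.mul_self_sqrt (abs_nonneg _)]
  simp only [e, integral_const_mul]
  rw [integral_neg_eq_self (fun b => 𝓕 (waveletSymbol f' ψ' a) b *
    conj (𝓕 (waveletSymbol g' ψ' a) b)), ← h1.integral_mul_conj h2]
  have h3 := integral_comp_continuousLinearEquiv (transposeEquiv a)
    (fun η => waveletSymbol f' ψ' a η * conj (waveletSymbol g' ψ' a η))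
  rw [det_transposeEquiv] at h3
  rw [← h3]
  congr 1 with ξ
  simp only [waveletSymbol, ContinuousLinearEquiv.symm_apply_apply, map_mul, Complex.conj_conj]
  rw [Complex.ofReal_pow, ← Complex.mul_conj']
  ring

end WaveletTransform

theorem Measurable.comp_fst_fst_snd {α β γ δ : Type*} [MeasurableSpace α] [MeasurableSpace β]
    [MeasurableSpace γ] [MeasurableSpace δ] {f : α × β → δ} (hf : Measurable f) :
    Measurable fun q : (α × γ) × β => f (q.1.1, q.2) :=
  hf.comp ((measurable_fst.comp measurable_fst).prodMk measurable_snd)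

/-! ### Wavelets correspond to integrable functions with orbit integrals one -/

section OrbitIntegral

open Matrix.GeneralLinearGroup

variable {n : ℕ} (G : Subgroup (GL (Fin n) ℝ)) [MeasurableSpace G] [BorelSpace G]

theorem measurable_transposeEquiv :
    Measurable fun p : G × EuclideanSpace ℝ (Fin n) => transposeEquiv (p.1 : GL (Fin n) ℝ) p.2 := by
  have h0 : Continuous fun p : G × EuclideanSpace ℝ (Fin n) => ((p.1 : GL (Fin n) ℝ), p.2) :=
    (continuous_subtype_val.comp continuous_fst).prodMk continuous_snd
  exact (continuous_transposeEquiv.comp h0).measurable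

/-- The Fourier transform of a wavelet has constant orbit integrals. -/
theorem IsContinuousWavelet.exists_lintegral_eq_one {μ : Measure G} [SFinite μ]
    {ψ : EuclideanSpace ℝ (Fin n) → ℂ} (h : IsContinuousWavelet G μ ψ) :
    ∃ F : EuclideanSpace ℝ (Fin n) → ℝ≥0∞, Measurable F ∧ ∫⁻ ξ, F ξ ≠ ⊤ ∧
      ∀ᵐ ξ, ∫⁻ a : G, F (transposeEquiv (a : GL (Fin n) ℝ) ξ) ∂μ = 1 := by
  obtain ⟨hψ, h⟩ := h
  obtain ⟨ψ', hmeas, hψ'⟩ := hψ.exists_isL2Fourier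
  have hFm : Measurable fun ξ => ‖ψ' ξ‖ₑ ^ 2 := by fun_prop
  have hFi : ∫⁻ ξ, ‖ψ' ξ‖ₑ ^ 2 < ⊤ :=
    (memLp_two_iff_lintegral hmeas.aestronglyMeasurable).1 hψ'.memLp_right
  have hFT : Measurable fun p : G × EuclideanSpace ℝ (Fin n) =>
      ‖ψ' (transposeEquiv (p.1 : GL (Fin n) ℝ) p.2)‖ₑ ^ 2 :=
    hFm.comp (measurable_transposeEquiv G)
  refine ⟨fun ξ => ‖ψ' ξ‖ₑ ^ 2, hFm, hFi.ne, ?_⟩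
  refine ae_eq_of_forall_setLIntegral_eq_of_sigmaFinite ?_ measurable_const fun E hE hEfin => ?_
  · exact Measurable.lintegral_prod_left' hFT
  rw [setLIntegral_one]
  have hE2 : MemLp (E.indicator fun _ => (1 : ℂ)) 2
      (volume : Measure (EuclideanSpace ℝ (Fin n))) :=
    memLp_indicator_const 2 hE 1 (Or.inr hEfin.ne)
  -- The reproducing formula is tested on `f = g` with `f̂ = 1_E`: one side is `|E|`, the other the
  -- integral of the orbit integrals over `E`.
  obtain ⟨f, -, hf⟩ := hE2.exists_isL2Fourier_eq
  obtain ⟨hint, heq⟩ := h f f hf.memLp_left hf.memLp_left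
  have hcs : ∀ p : G × EuclideanSpace ℝ (Fin n),
      l2Inner f (dilateTranslate ψ p.1 p.2) * l2Inner (dilateTranslate ψ p.1 p.2) f =
        ((‖l2Inner f (dilateTranslate ψ p.1 p.2)‖ ^ 2 : ℝ) : ℂ) := by
    intro p
    rw [l2Inner_swap f, Complex.mul_conj', Complex.ofReal_pow]
  simp only [hcs] at hint heq
  have hen : ∀ z : ℂ, ‖((‖z‖ ^ 2 : ℝ) : ℂ)‖ₑ = ‖z‖ₑ ^ 2 := by
    intro z
    rw [← ofReal_norm, Complex.norm_real, norm_pow, norm_norm, ENNReal.ofReal_pow (norm_nonneg _),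
      ofReal_norm]
  have h1 : ∫⁻ p : G × EuclideanSpace ℝ (Fin n), ‖l2Inner f (dilateTranslate ψ p.1 p.2)‖ₑ ^ 2
      ∂(μ.prod volume) = volume E := by
    have h2 := ofReal_integral_norm_eq_lintegral_enorm hint
    simp only [hen] at h2
    rw [← h2]
    have h3 : l2Inner f f = ((volume.real E : ℝ) : ℂ) := by
      rw [l2Inner, hf.integral_mul_conj hf]
      have : ∀ x, E.indicator (fun _ => (1 : ℂ)) x * conj (E.indicator (fun _ => (1 : ℂ)) x)
          = E.indicator (fun _ => (1 : ℂ)) x := by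
        intro x
        by_cases hx : x ∈ E <;> simp [hx]
      simp only [this]
      rw [integral_indicator hE]
      simp
    rw [h3, integral_complex_ofReal] at heq
    have h4 := Complex.ofReal_injective heq
    simp only [Complex.norm_real, norm_pow, norm_norm]
    rw [h4, ofReal_measureReal hEfin.ne]
  have hm : AEMeasurable (fun p : G × EuclideanSpace ℝ (Fin n) =>
      ‖l2Inner f (dilateTranslate ψ p.1 p.2)‖ₑ ^ 2) (μ.prod volume) := by
    simpa only [hen] using hint.aestronglyMeasurable.enorm
  rw [lintegral_prod _ hm] at h1
  have hind : ∀ (a : G) ξ, ‖E.indicator (fun _ => (1 : ℂ)) ξ‖ₑ ^ 2 *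
      ‖ψ' (transposeEquiv (a : GL (Fin n) ℝ) ξ)‖ₑ ^ 2 =
      E.indicator (fun ξ => ‖ψ' (transposeEquiv (a : GL (Fin n) ℝ) ξ)‖ₑ ^ 2) ξ := by
    intro a ξ
    by_cases hx : ξ ∈ E <;> simp [hx]
  have h5 : ∀ a : G, ∫⁻ b, ‖l2Inner f (dilateTranslate ψ (a : GL (Fin n) ℝ) b)‖ₑ ^ 2 =
      ∫⁻ ξ in E, ‖ψ' (transposeEquiv (a : GL (Fin n) ℝ) ξ)‖ₑ ^ 2 := by
    intro a
    rw [lintegral_enorm_l2Inner_dilateTranslate hf hψ' a]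
    · simp only [hind]
      rw [lintegral_indicator hE]
    · simp only [hind]
      rw [lintegral_indicator hE]
      refine ((setLIntegral_le_lintegral _ _).trans_lt ?_).ne
      rw [lintegral_comp_continuousLinearEquiv (transposeEquiv (a : GL (Fin n) ℝ))
        (fun ξ => ‖ψ' ξ‖ₑ ^ 2)]
      exact ENNReal.mul_lt_top ENNReal.ofReal_lt_top hFi
  simp only [h5] at h1
  rw [← h1, lintegral_lintegral_swap]
  exact (hFT.comp measurable_swap).aemeasurable

theorem stronglyMeasurable_l2Inner_dilateTranslate {f ψ : EuclideanSpace ℝ (Fin n) → ℂ}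
    (hf : AEStronglyMeasurable f volume) (hψ : Measurable ψ) :
    StronglyMeasurable fun p : G × EuclideanSpace ℝ (Fin n) =>
      l2Inner f (dilateTranslate ψ p.1 p.2) := by
  have h0 : ∀ p : G × EuclideanSpace ℝ (Fin n), l2Inner f (dilateTranslate ψ p.1 p.2) =
      ∫ x, hf.mk f x * conj ((((√|((p.1 : GL (Fin n) ℝ) : Matrix (Fin n) (Fin n) ℝ).det|)⁻¹ : ℝ)
        : ℂ) * ψ ((euclideanEquiv (p.1 : GL (Fin n) ℝ)).symm x - p.2)) := by
    intro p
    refine integral_congr_ae ?_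
    filter_upwards [hf.ae_eq_mk] with x hx
    rw [hx]
    rfl
  simp only [h0]
  refine StronglyMeasurable.integral_prod_right ?_
  refine Measurable.stronglyMeasurable ?_
  have hd : Continuous fun a : G =>
      |((a : GL (Fin n) ℝ) : Matrix (Fin n) (Fin n) ℝ).det| :=
    ((Units.continuous_val.comp continuous_subtype_val).matrix_det).abs
  have h1 : Measurable fun q : (G × EuclideanSpace ℝ (Fin n)) × EuclideanSpace ℝ (Fin n) =>
      (euclideanEquiv (q.1.1 : GL (Fin n) ℝ)).symm q.2 := by
    have h0 : Continuous fun p : G × EuclideanSpace ℝ (Fin n) =>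
        ((p.1 : GL (Fin n) ℝ), p.2) :=
      (continuous_subtype_val.comp continuous_fst).prodMk continuous_snd
    exact (continuous_euclideanEquiv_symm.comp h0).measurable.comp_fst_fst_snd
  have h2 := hf.stronglyMeasurable_mk.measurable
  have h3 := hd.measurable
  refine (h2.comp measurable_snd).mul (Complex.continuous_conj.measurable.comp (Measurable.mul ?_
    (hψ.comp (h1.sub (measurable_snd.comp measurable_fst)))))
  exact Complex.measurable_ofReal.comp
    (((h3.comp (measurable_fst.comp measurable_fst)).sqrt).inv)

/-- A square integrable function with constant orbit integrals is the squared modulus of the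
Fourier transform of a wavelet. -/
theorem exists_isContinuousWavelet {μ : Measure G} [SFinite μ]
    {F : EuclideanSpace ℝ (Fin n) → ℝ≥0∞} (hF : Measurable F) (hFtop : ∀ ξ, F ξ ≠ ⊤)
    (hFi : ∫⁻ ξ, F ξ ≠ ⊤)
    (h1 : ∀ᵐ ξ, ∫⁻ a : G, F (transposeEquiv (a : GL (Fin n) ℝ) ξ) ∂μ = 1) :
    ∃ ψ : EuclideanSpace ℝ (Fin n) → ℂ, IsContinuousWavelet G μ ψ := by
  set ψ' : EuclideanSpace ℝ (Fin n) → ℂ := fun ξ => ((√(F ξ).toReal : ℝ) : ℂ) with hψ'def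
  have hψ'm : Measurable ψ' := Complex.measurable_ofReal.comp hF.ennreal_toReal.sqrt
  have hψ'F : ∀ ξ, ‖ψ' ξ‖ₑ ^ 2 = F ξ := by
    intro ξ
    rw [hψ'def, ← ofReal_norm, Complex.norm_real, Real.norm_of_nonneg (Real.sqrt_nonneg _),
      ← ENNReal.ofReal_pow (Real.sqrt_nonneg _), Real.sq_sqrt ENNReal.toReal_nonneg,
      ENNReal.ofReal_toReal (hFtop ξ)]
  have hψ'2 : MemLp ψ' 2 volume := by
    rw [memLp_two_iff_lintegral hψ'm.aestronglyMeasurable]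
    simpa only [hψ'F] using hFi.lt_top
  obtain ⟨ψ, hψm, hψ⟩ := hψ'2.exists_isL2Fourier_eq
  have hFT : Measurable fun p : G × EuclideanSpace ℝ (Fin n) =>
      F (transposeEquiv (p.1 : GL (Fin n) ℝ) p.2) := hF.comp (measurable_transposeEquiv G)
  have hψT : Measurable fun p : G × EuclideanSpace ℝ (Fin n) =>
      ψ' (transposeEquiv (p.1 : GL (Fin n) ℝ) p.2) := hψ'm.comp (measurable_transposeEquiv G)
  -- Tonelli and the orbit condition give the first identity. It makes the inner integral finite for
  -- almost every `a`, where Plancherel at fixed scale applies. The wavelet transform is therefore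
  -- in `L²(G × ℝⁿ)`, and a product of two such transforms is integrable.
  have key : ∀ f f' : EuclideanSpace ℝ (Fin n) → ℂ, Measurable f' → IsL2Fourier f f' →
      (∫⁻ a : G, ∫⁻ ξ, ‖f' ξ‖ₑ ^ 2 * F (transposeEquiv (a : GL (Fin n) ℝ) ξ) ∂volume ∂μ =
        ∫⁻ ξ, ‖f' ξ‖ₑ ^ 2) ∧
      (∀ᵐ a : G ∂μ, ∫⁻ ξ, ‖f' ξ‖ₑ ^ 2 * F (transposeEquiv (a : GL (Fin n) ℝ) ξ) ≠ ⊤) ∧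
      MemLp (fun p : G × EuclideanSpace ℝ (Fin n) => l2Inner f (dilateTranslate ψ p.1 p.2)) 2
        (μ.prod volume) := by
    intro f f' hm hf
    have hf'2 : Measurable fun ξ => ‖f' ξ‖ₑ ^ 2 := by fun_prop
    have hmm : Measurable fun p : G × EuclideanSpace ℝ (Fin n) =>
      ‖f' p.2‖ₑ ^ 2 * F (transposeEquiv (p.1 : GL (Fin n) ℝ) p.2) :=
      (hf'2.comp measurable_snd).mul hFT
    have e1 : ∫⁻ a : G, ∫⁻ ξ, ‖f' ξ‖ₑ ^ 2 * F (transposeEquiv (a : GL (Fin n) ℝ) ξ) ∂volume ∂μ =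
        ∫⁻ ξ, ‖f' ξ‖ₑ ^ 2 := by
      rw [lintegral_lintegral_swap hmm.aemeasurable]
      refine lintegral_congr_ae ?_
      filter_upwards [h1] with ξ hξ
      rw [lintegral_const_mul' _ _ (by simp), hξ, mul_one]
    have e0 : ∫⁻ ξ, ‖f' ξ‖ₑ ^ 2 < ⊤ :=
      (memLp_two_iff_lintegral hm.aestronglyMeasurable).1 hf.memLp_right
    have e2 : ∀ᵐ a : G ∂μ, ∫⁻ ξ, ‖f' ξ‖ₑ ^ 2 *
        F (transposeEquiv (a : GL (Fin n) ℝ) ξ) ≠ ⊤ := by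
      have := ae_lt_top (μ := μ) (Measurable.lintegral_prod_right' hmm) (by
        rw [e1]; exact e0.ne)
      filter_upwards [this] with a ha using ha.ne
    refine ⟨e1, e2, ?_⟩
    have hV := stronglyMeasurable_l2Inner_dilateTranslate G hf.memLp_left.aestronglyMeasurable hψm
    rw [memLp_two_iff_lintegral hV.aestronglyMeasurable, lintegral_prod _
      (hV.measurable.enorm.pow_const 2).aemeasurable]
    refine lt_of_eq_of_lt (lintegral_congr_ae ?_) (e1.trans_lt e0)
    filter_upwards [e2] with a ha
    simp only [← hψ'F] at ha ⊢
    exact lintegral_enorm_l2Inner_dilateTranslate hf hψ a ha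
  refine ⟨ψ, hψ.memLp_left, fun f g hf hg => ?_⟩
  obtain ⟨f', hfm, hf'⟩ := hf.exists_isL2Fourier
  obtain ⟨g', hgm, hg'⟩ := hg.exists_isL2Fourier
  obtain ⟨f1, f2, f3⟩ := key f f' hfm hf'
  obtain ⟨g1, g2, g3⟩ := key g g' hgm hg'
  have hint : Integrable (fun p : G × EuclideanSpace ℝ (Fin n) =>
      l2Inner f (dilateTranslate ψ p.1 p.2) * l2Inner (dilateTranslate ψ p.1 p.2) g)
      (μ.prod volume) := by
    simp only [l2Inner_swap g (dilateTranslate ψ _ _)]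
    exact f3.integrable_mul g3.complex_conj
  refine ⟨hint, ?_⟩
  rw [integral_prod _ hint]
  have hA : MemLp (fun p : G × EuclideanSpace ℝ (Fin n) =>
      f' p.2 * ψ' (transposeEquiv (p.1 : GL (Fin n) ℝ) p.2)) 2 (μ.prod volume) ∧
      MemLp (fun p : G × EuclideanSpace ℝ (Fin n) =>
      g' p.2 * ψ' (transposeEquiv (p.1 : GL (Fin n) ℝ) p.2)) 2 (μ.prod volume) := by
    have gen : ∀ f' : EuclideanSpace ℝ (Fin n) → ℂ, Measurable f' → MemLp f' 2 volume →
        ∫⁻ a : G, ∫⁻ ξ, ‖f' ξ‖ₑ ^ 2 * F (transposeEquiv (a : GL (Fin n) ℝ) ξ) ∂volume ∂μ =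
          ∫⁻ ξ, ‖f' ξ‖ₑ ^ 2 →
        MemLp (fun p : G × EuclideanSpace ℝ (Fin n) =>
          f' p.2 * ψ' (transposeEquiv (p.1 : GL (Fin n) ℝ) p.2)) 2 (μ.prod volume) := by
      intro f' hm h2 he
      have hmm : Measurable fun p : G × EuclideanSpace ℝ (Fin n) =>
          f' p.2 * ψ' (transposeEquiv (p.1 : GL (Fin n) ℝ) p.2) :=
        (hm.comp measurable_snd).mul hψT
      rw [memLp_two_iff_lintegral hmm.aestronglyMeasurable, lintegral_prod _
        (hmm.enorm.pow_const 2).aemeasurable]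
      simp only [enorm_mul, mul_pow, hψ'F]
      rw [he]
      exact (memLp_two_iff_lintegral hm.aestronglyMeasurable).1 h2
    exact ⟨gen f' hfm hf'.memLp_right f1, gen g' hgm hg'.memLp_right g1⟩
  have hint2 : Integrable (fun p : G × EuclideanSpace ℝ (Fin n) => f' p.2 * conj (g' p.2) *
      ((‖ψ' (transposeEquiv (p.1 : GL (Fin n) ℝ) p.2)‖ ^ 2 : ℝ) : ℂ)) (μ.prod volume) := by
    refine (hA.1.integrable_mul hA.2.complex_conj).congr (ae_of_all _ fun p => ?_)
    simp only [Pi.mul_apply, map_mul, Complex.ofReal_pow, ← Complex.mul_conj']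
    ring
  calc
    _ = ∫ a : G, ∫ ξ, f' ξ * conj (g' ξ) *
        ((‖ψ' (transposeEquiv (a : GL (Fin n) ℝ) ξ)‖ ^ 2 : ℝ) : ℂ) ∂volume ∂μ := by
      refine integral_congr_ae ?_
      filter_upwards [f2, g2] with a hfa hga
      simp only [← hψ'F] at hfa hga
      simp only [l2Inner_swap g (dilateTranslate ψ _ _)]
      exact integral_l2Inner_dilateTranslate_mul_conj hf' hg' hψ a hfa hga
    _ = ∫ ξ, ∫ a : G, f' ξ * conj (g' ξ) *
        ((‖ψ' (transposeEquiv (a : GL (Fin n) ℝ) ξ)‖ ^ 2 : ℝ) : ℂ) ∂μ :=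
      integral_integral_swap hint2
    _ = ∫ ξ, f' ξ * conj (g' ξ) := by
      refine integral_congr_ae ?_
      filter_upwards [h1] with ξ hξ
      rw [integral_const_mul, integral_complex_ofReal]
      have : ∫ a : G, ‖ψ' (transposeEquiv (a : GL (Fin n) ℝ) ξ)‖ ^ 2 ∂μ = 1 := by
        rw [integral_eq_lintegral_of_nonneg_ae (ae_of_all _ fun a => by positivity)]
        · have e : ∀ a : G, ENNReal.ofReal (‖ψ' (transposeEquiv (a : GL (Fin n) ℝ) ξ)‖ ^ 2) =
              F (transposeEquiv (a : GL (Fin n) ℝ) ξ) := by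
            intro a
            rw [← hψ'F, ENNReal.ofReal_pow (norm_nonneg _), ofReal_norm]
          simp only [e, hξ, ENNReal.toReal_one]
        · have := hψT.comp (measurable_prodMk_right (y := ξ))
          exact (this.norm.pow_const 2).aestronglyMeasurable
      rw [this]
      simp
    _ = l2Inner f g := (hf'.integral_mul_conj hg').symm

end OrbitIntegral

/-! ### Trace zero: no integrable function has orbit integrals one -/

theorem MeasureTheory.Measure.exists_inv_eq_smul {H : Type*} [Group H] [MeasurableSpace H]
    [MeasurableMul₂ H] [MeasurableInv H] (hcomm : ∀ a b : H, a * b = b * a) (μ : Measure H)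
    [SigmaFinite μ] [μ.IsMulLeftInvariant] [NeZero μ] : ∃ c : ℝ≥0∞, μ.inv = c • μ := by
  -- Right invariance of `μ` makes `μ.inv` left invariant, so uniqueness up to scalars applies,
  -- normalized on a spanning set of positive finite measure.
  have : μ.IsMulRightInvariant := ⟨fun g => by
    simp only [hcomm _ g]
    exact map_mul_left_eq_self μ g⟩
  obtain ⟨k, hk⟩ := exists_measure_pos_of_not_measure_iUnion_null (μ := μ)
    (s := spanningSets μ) (by
      rw [iUnion_spanningSets]
      simpa using NeZero.ne μ)
  exact ⟨_, measure_eq_div_smul μ.inv μ hk.ne' (measure_spanningSets_lt_top μ k).ne⟩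

theorem Measurable.comp_inv_fst {α β γ : Type*} [MeasurableSpace α] [MeasurableSpace β]
    [MeasurableSpace γ] [Inv α] [MeasurableInv α] {f : α × β → γ} (hf : Measurable f) :
    Measurable fun p : α × β => f (p.1⁻¹, p.2) :=
  hf.comp (measurable_fst.inv.prodMk measurable_snd)

/-- Integrate `F(Rξ) F(T_a ξ)` over both variables. The `a`-integral gives the left side;
substituting `T_a⁻¹ ξ` for `ξ`, free since `|det T_a| = 1`, leaves an orbit integral at `Rξ` over
inverses, which is `c`. The point is that the right side does not involve `R`. -/
theorem lintegral_comp_eq_of_commute {V H : Type*} [NormedAddCommGroup V] [InnerProductSpace ℝ V]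
    [FiniteDimensional ℝ V] [MeasurableSpace V] [BorelSpace V] [Group H] [MeasurableSpace H]
    [MeasurableInv H] {μ : Measure H} [SFinite μ] {T : H → V ≃L[ℝ] V}
    (hT : Measurable fun p : H × V => T p.1 p.2) (hTinv : ∀ a, T a⁻¹ = (T a).symm)
    (hdet : ∀ a, |LinearMap.det (T a : V →ₗ[ℝ] V)| = 1)
    {c : ℝ≥0∞} (hc : μ.inv = c • μ) {F : V → ℝ≥0∞} (hF : Measurable F)
    (h1 : ∀ᵐ ξ, ∫⁻ a, F (T a ξ) ∂μ = 1) (R : V ≃L[ℝ] V) (hR : ∀ a ξ, R (T a ξ) = T a (R ξ)) :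
    ∫⁻ ξ, F (R ξ) = c * ∫⁻ ξ, F ξ := by
  have hFT : Measurable fun p : H × V => F (T p.1 p.2) := hF.comp hT
  have hFR : Measurable fun ξ => F (R ξ) := hF.comp R.continuous.measurable
  have hFT' : Measurable fun p : H × V => F (R (T p.1⁻¹ p.2)) := (hFR.comp hT).comp_inv_fst
  have hΦ : ∀ᵐ ξ, ∫⁻ a, F (T a (R ξ)) ∂μ = 1 :=
    (quasiMeasurePreserving_continuousLinearEquiv R).ae h1
  calc
    ∫⁻ ξ, F (R ξ) = ∫⁻ ξ, ∫⁻ a, F (R ξ) * F (T a ξ) ∂μ := by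
      refine lintegral_congr_ae ?_
      filter_upwards [h1] with ξ hξ
      have hm : Measurable fun a => F (T a ξ) :=
        hFT.comp (measurable_prodMk_right (y := ξ))
      rw [lintegral_const_mul _ hm, hξ, mul_one]
    _ = ∫⁻ a, ∫⁻ ξ, F (R ξ) * F (T a ξ) ∂volume ∂μ :=
      lintegral_lintegral_swap
        (((hFR.comp measurable_snd).mul hFT).comp measurable_swap).aemeasurable
    _ = ∫⁻ a, ∫⁻ ξ, F (R (T a⁻¹ ξ)) * F ξ
        ∂volume ∂μ := by
      refine lintegral_congr fun a => ?_
      have h := lintegral_comp_continuousLinearEquiv (T a)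
        (fun ξ => F (R (T a⁻¹ ξ)) * F ξ)
      rw [hdet] at h
      simp only [inv_one, ENNReal.ofReal_one, one_mul] at h
      rw [← h]
      refine lintegral_congr fun ξ => ?_
      rw [hTinv, ContinuousLinearEquiv.symm_apply_apply]
    _ = ∫⁻ ξ, ∫⁻ a, F (R (T a⁻¹ ξ)) * F ξ ∂μ :=
      lintegral_lintegral_swap (hFT'.mul (hF.comp measurable_snd)).aemeasurable
    _ = ∫⁻ ξ, c * F ξ := by
      refine lintegral_congr_ae ?_
      filter_upwards [hΦ] with ξ hξ
      have hm' : Measurable fun a =>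
          F (R (T a⁻¹ ξ)) :=
        hFT'.comp (measurable_prodMk_right (y := ξ))
      rw [lintegral_mul_const _ hm']
      congr 1
      have hm : Measurable fun a => F (T a (R ξ)) :=
        hFT.comp (measurable_prodMk_right (y := R ξ))
      have h := lintegral_map (μ := μ) hm measurable_inv
      rw [← Measure.inv_def, hc, lintegral_smul_measure, hξ] at h
      simp only [hR, ← h, smul_eq_mul, mul_one]
    _ = c * ∫⁻ ξ, F ξ := lintegral_const_mul _ hF

section Unimodular

open Matrix.GeneralLinearGroup

variable {n : ℕ} (G : Subgroup (GL (Fin n) ℝ)) [MeasurableSpace G] [BorelSpace G]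

/-- For a commutative group of matrices of determinant `±1` there is no integrable function with
constant orbit integrals. -/
theorem lintegral_eq_top_of_abs_det_eq_one [NeZero n] {μ : Measure G} [SigmaFinite μ]
    [μ.IsMulLeftInvariant] [NeZero μ]
    (hcomm : ∀ a b : G, a * b = b * a)
    (hdet : ∀ a ∈ G, |(a : Matrix (Fin n) (Fin n) ℝ).det| = 1)
    {F : EuclideanSpace ℝ (Fin n) → ℝ≥0∞} (hF : Measurable F)
    (h1 : ∀ᵐ ξ, ∫⁻ a : G, F (transposeEquiv (a : GL (Fin n) ℝ) ξ) ∂μ = 1) :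
    ∫⁻ ξ, F ξ = ⊤ := by
  have := secondCountableTopology_subgroup G
  by_contra hfin
  obtain ⟨c, hc⟩ : ∃ c : ℝ≥0∞, μ.inv = c • μ := by
    exact Measure.exists_inv_eq_smul hcomm μ
  have hTinv : ∀ a : G, transposeEquiv ((a⁻¹ : G) : GL (Fin n) ℝ) =
      (transposeEquiv (a : GL (Fin n) ℝ)).symm := fun a => by
    rw [Subgroup.coe_inv, transposeEquiv_symm]
  have hdet' : ∀ a : G, |LinearMap.det (transposeEquiv (a : GL (Fin n) ℝ) :
      EuclideanSpace ℝ (Fin n) →ₗ[ℝ] _)| = 1 := fun a => by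
    rw [det_transposeEquiv, hdet _ a.2]
  have e1 := lintegral_comp_eq_of_commute (measurable_transposeEquiv G) hTinv hdet' hc hF h1
    (.refl ℝ _) (fun _ _ => rfl)
  set R : EuclideanSpace ℝ (Fin n) ≃L[ℝ] EuclideanSpace ℝ (Fin n) :=
    ContinuousLinearEquiv.smulLeft (Units.mk0 (2 : ℝ) two_ne_zero) with hRdef
  have hRa : ∀ ξ, R ξ = (2 : ℝ) • ξ := fun ξ => rfl
  have e2 := lintegral_comp_eq_of_commute (measurable_transposeEquiv G) hTinv hdet' hc hF h1 R
    (fun a ξ => by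
    rw [hRa, hRa, map_smul])
  have hRd : LinearMap.det (R : EuclideanSpace ℝ (Fin n) →ₗ[ℝ] _) = 2 ^ n := by
    have : (R : EuclideanSpace ℝ (Fin n) →ₗ[ℝ] EuclideanSpace ℝ (Fin n)) =
      (2 : ℝ) • LinearMap.id := rfl
    rw [this, LinearMap.det_smul]
    simp
  rw [lintegral_comp_continuousLinearEquiv, hRd] at e2
  simp only [ContinuousLinearEquiv.refl_apply] at e1
  rw [← e1] at e2
  -- Now `e2` reads `2⁻ⁿ ∫ F = ∫ F` with `∫ F` finite and `n ≥ 1`.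
  have hC : ∫⁻ ξ, F ξ = 0 := by
    by_contra h0
    have h2 : ENNReal.ofReal |(2 : ℝ) ^ n|⁻¹ = 1 := by
      rwa [ENNReal.mul_eq_right h0 hfin] at e2
    rw [ENNReal.ofReal_eq_one, inv_eq_one, abs_of_pos (by positivity)] at h2
    exact (one_lt_pow₀ (one_lt_two (α := ℝ)) (NeZero.ne n)).ne' h2
  have hFT : Measurable fun p : G × EuclideanSpace ℝ (Fin n) =>
      F (transposeEquiv (p.1 : GL (Fin n) ℝ) p.2) := hF.comp (measurable_transposeEquiv G)
  -- Integrating the orbit condition over `ξ` gives `0` on one side and the total volume of the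
  -- space on the other.
  have h3 := lintegral_congr_ae h1
  rw [lintegral_lintegral_swap
    (f := fun ξ (a : G) => F (transposeEquiv (a : GL (Fin n) ℝ) ξ))
    (hFT.comp measurable_swap).aemeasurable] at h3
  simp only [lintegral_comp_continuousLinearEquiv, hC, mul_zero, lintegral_zero,
    lintegral_one] at h3
  exact (NeZero.ne (volume : Measure (EuclideanSpace ℝ (Fin n))))
    (Measure.measure_univ_eq_zero.1 h3.symm)

end Unimodular

/-! ### Nonzero trace: orbit integrals of measure-scaling flows -/

section Flow

variable {V : Type*} [MeasurableSpace V] {ν : Measure V}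

/-- Orbitwise shifting and normalization of a function with finite positive orbit integrals, for
a flow that contracts the measure. -/
theorem exists_lintegral_orbit_eq_one_of_pos {S : ℝ → V → V}
    (hS : Measurable fun p : ℝ × V => S p.1 p.2)
    (hadd : ∀ s t x, S (s + t) x = S s (S t x)) {τ : ℝ} (hτ : 0 < τ)
    (hν : ∀ t (f : V → ℝ≥0∞), Measurable f →
      ∫⁻ x, f (S t x) ∂ν = ENNReal.ofReal (Real.exp (-(τ * t))) * ∫⁻ x, f x ∂ν)
    {f : V → ℝ≥0∞} (hf : Measurable f) (hftop : ∀ x, f x ≠ ⊤) (hfi : ∫⁻ x, f x ∂ν ≠ ⊤)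
    (hpos : ∀ᵐ x ∂ν, ∫⁻ t, f (S t x) ≠ 0 ∧ ∫⁻ t, f (S t x) ≠ ⊤) :
    ∃ F : V → ℝ≥0∞, Measurable F ∧ (∀ x, F x ≠ ⊤) ∧ ∫⁻ x, F x ∂ν ≠ ⊤ ∧
      ∀ᵐ x ∂ν, ∫⁻ t, F (S t x) = 1 := by
  set Φ : V → ℝ≥0∞ := fun x => ∫⁻ t, f (S t x) with hΦ
  have hΦm : Measurable Φ := Measurable.lintegral_prod_left' (hf.comp hS)
  have hΦS : ∀ s x, Φ (S s x) = Φ x := by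
    intro s x
    simp only [hΦ, ← hadd]
    exact lintegral_add_right_eq_self (fun t => f (S t x)) s
  have hSt : ∀ t, Measurable (S t) := fun t => hS.comp measurable_prodMk_left
  -- The least natural number with `e^{-τκ} ≤ Φ` where `Φ` is finite and positive. It is constant on
  -- orbits, and being integer valued it splits the space into countably many invariant pieces, each
  -- moved by a single time.
  set κ : V → ℕ := fun x => ⌈-Real.log (Φ x).toReal / τ⌉₊ with hκ
  have hκm : Measurable κ :=
    Nat.measurable_ceil.comp (((Real.measurable_log.comp hΦm.ennreal_toReal).neg).div_const τ)
  have hκS : ∀ s x, κ (S s x) = κ x := fun s x => by simp only [hκ, hΦS]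
  have hκle : ∀ x, Φ x ≠ 0 → Φ x ≠ ⊤ → ENNReal.ofReal (Real.exp (-(τ * κ x))) ≤ Φ x := by
    intro x h0 htop
    have hp : 0 < (Φ x).toReal := ENNReal.toReal_pos h0 htop
    rw [ENNReal.ofReal_le_iff_le_toReal htop, ← Real.le_log_iff_exp_le hp]
    have := Nat.le_ceil (-Real.log (Φ x).toReal / τ)
    rw [div_le_iff₀ hτ] at this
    have h2 : ((κ x : ℕ) : ℝ) = (⌈-Real.log (Φ x).toReal / τ⌉₊ : ℝ) := rfl
    rw [h2]
    linarith
  set A : Set V := {x | Φ x ≠ 0 ∧ Φ x ≠ ⊤} with hA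
  have hAm : MeasurableSet A :=
    (hΦm (measurableSet_singleton 0).compl).inter (hΦm (measurableSet_singleton ⊤).compl)
  have hAS : ∀ s x, S s x ∈ A ↔ x ∈ A := fun s x => by
    simp only [hA, Set.mem_ofPred_eq, hΦS]
  have hSκ : Measurable fun x => S (κ x) x := by
    have h0 : Measurable fun x => ((κ x : ℝ), x) :=
      ((measurable_from_nat (f := fun k : ℕ => (k : ℝ))).comp hκm).prodMk measurable_id
    exact hS.comp h0
  set F : V → ℝ≥0∞ := A.indicator fun x => f (S (κ x) x) * (Φ x)⁻¹ with hFdef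
  have hFm : Measurable F := ((hf.comp hSκ).mul hΦm.inv).indicator hAm
  refine ⟨F, hFm, fun x => ?_, ?_, ?_⟩
  · by_cases hx : x ∈ A
    · simp only [hFdef, Set.indicator_of_mem hx]
      exact ENNReal.mul_ne_top (hftop _) (ENNReal.inv_ne_top.2 hx.1)
    · simp [hFdef, hx]
  · set g : ℕ → V → ℝ≥0∞ := fun k => (A ∩ κ ⁻¹' {k}).indicator fun x => f x * (Φ x)⁻¹ with hg
    have hgs : ∀ k, MeasurableSet (A ∩ κ ⁻¹' {k}) :=
      fun k => hAm.inter (hκm (measurableSet_singleton k))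
    have hgm : ∀ k, Measurable (g k) := fun k => (hf.mul hΦm.inv).indicator (hgs k)
    have h1 : ∀ x, F x ≤ ∑' k, g k (S k x) := by
      intro x
      by_cases hx : x ∈ A
      · refine le_trans (le_of_eq ?_) (ENNReal.le_tsum (κ x))
        have hx' : S (κ x) x ∈ A ∩ κ ⁻¹' {κ x} := ⟨(hAS _ _).2 hx, hκS _ _⟩
        simp only [hFdef, hg, Set.indicator_of_mem hx, Set.indicator_of_mem hx', hΦS]
      · simp [hFdef, hx]
    -- On the piece `κ = k`, the factor `e^{-τk} ≤ Φ` gained from the flow cancels the division by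
    -- `Φ`.
    have h2 : ∀ (k : ℕ) x, ENNReal.ofReal (Real.exp (-(τ * k))) * g k x ≤
        (κ ⁻¹' {k}).indicator f x := by
      intro k x
      by_cases hx : x ∈ A ∩ κ ⁻¹' {k}
      · simp only [hg, Set.indicator_of_mem hx, Set.indicator_of_mem hx.2]
        have hk : κ x = k := hx.2
        have h3 := hκle x hx.1.1 hx.1.2
        rw [hk] at h3
        calc _ ≤ Φ x * (f x * (Φ x)⁻¹) := by gcongr
          _ = f x * (Φ x * (Φ x)⁻¹) := by ring
          _ = f x := by rw [ENNReal.mul_inv_cancel hx.1.1 hx.1.2, mul_one]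
      · simp [hg, hx]
    refine (lt_of_le_of_lt ?_ hfi.lt_top).ne
    calc ∫⁻ x, F x ∂ν ≤ ∫⁻ x, ∑' k, g k (S k x) ∂ν := lintegral_mono h1
      _ = ∑' k, ∫⁻ x, g k (S k x) ∂ν :=
        lintegral_tsum fun k => ((hgm k).comp (hSt k)).aemeasurable
      _ = ∑' k : ℕ, ∫⁻ x, ENNReal.ofReal (Real.exp (-(τ * k))) * g k x ∂ν := by
        refine tsum_congr fun k => ?_
        rw [hν _ _ (hgm k), lintegral_const_mul _ (hgm k)]
      _ ≤ ∑' k : ℕ, ∫⁻ x, (κ ⁻¹' {k}).indicator f x ∂ν :=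
        ENNReal.tsum_le_tsum fun k => lintegral_mono (h2 k)
      _ = ∫⁻ x, ∑' k : ℕ, (κ ⁻¹' {k}).indicator f x ∂ν :=
        (lintegral_tsum fun k => (hf.indicator
          (hκm (measurableSet_singleton k))).aemeasurable).symm
      _ = ∫⁻ x, f x ∂ν := by
        refine lintegral_congr fun x => ?_
        rw [tsum_eq_single (κ x)]
        · exact Set.indicator_of_mem (by simp) f
        · intro k hk
          exact Set.indicator_of_notMem (fun h => hk h.symm) f
  · filter_upwards [hpos] with x hx
    have hxA : x ∈ A := hx
    have h1 : ∀ t, F (S t x) = f (S (t + κ x) x) * (Φ x)⁻¹ := by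
      intro t
      simp only [hFdef, Set.indicator_of_mem ((hAS t x).2 hxA), hκS, hΦS, ← hadd]
      rw [add_comm]
    simp only [h1]
    rw [lintegral_mul_const' _ _ (ENNReal.inv_ne_top.2 hx.1),
      lintegral_add_right_eq_self (fun t => f (S t x))]
    exact ENNReal.mul_inv_cancel hx.1 hx.2

/-- If `u` is positive, continuous and integrable at `+∞`, then `u · exp (-∫_t^∞ u)` has finite
positive integral over the real line. -/
theorem lintegral_mul_exp_neg_integral_Ioi {u : ℝ → ℝ} (hu : Continuous u) (hpos : ∀ t, 0 < u t)
    (hi : IntegrableOn u (Set.Ioi 0)) :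
    (∫⁻ s, ENNReal.ofReal (u s * Real.exp (-∫ t in Set.Ioi s, u t))) ≠ 0 ∧
      (∫⁻ s, ENNReal.ofReal (u s * Real.exp (-∫ t in Set.Ioi s, u t))) ≠ ⊤ := by
  have his : ∀ s, IntegrableOn u (Set.Ioi s) := by
    intro s
    have h1 : IntegrableOn u (Set.Icc s 0 ∪ Set.Ioi 0) := hu.integrableOn_Icc.union hi
    refine h1.mono_set fun t ht => ?_
    rcases le_or_gt t 0 with h | h
    · exact Or.inl ⟨le_of_lt ht, h⟩
    · exact Or.inr h
  have hU : ∀ s, ∫ t in Set.Ioi s, u t = (∫ t in Set.Ioi 0, u t) - ∫ t in (0:ℝ)..s, u t := by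
    intro s
    rw [← intervalIntegral.integral_Ioi_sub_Ioi' (his 0) (his s)]
    ring
  have hd : ∀ s, HasDerivAt (fun s => Real.exp (-∫ t in Set.Ioi s, u t))
      (u s * Real.exp (-∫ t in Set.Ioi s, u t)) s := by
    intro s
    have h1 : HasDerivAt (fun s => -∫ t in Set.Ioi s, u t) (u s) s := by
      have hU' : (fun s => -∫ t in Set.Ioi s, u t) =
          fun s => -((∫ t in Set.Ioi 0, u t) - ∫ t in (0:ℝ)..s, u t) :=
        funext fun s => by rw [hU s]
      rw [hU']
      have h2 := (intervalIntegral.integral_hasDerivAt_right (hu.intervalIntegrable 0 s)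
        (hu.stronglyMeasurableAtFilter _ _) hu.continuousAt).const_sub (∫ t in Set.Ioi 0, u t)
      rw [← neg_neg (u s)]
      exact h2.neg
    have h3 := h1.exp
    rwa [mul_comm] at h3
  have hge : ∀ s, 0 ≤ ∫ t in Set.Ioi s, u t := fun s => integral_nonneg fun t => (hpos t).le
  have hp : ∀ s, 0 < u s * Real.exp (-∫ t in Set.Ioi s, u t) :=
    fun s => mul_pos (hpos s) (Real.exp_pos _)
  have hmono : Monotone fun s => Real.exp (-∫ t in Set.Ioi s, u t) :=
    monotone_of_hasDerivAt_nonneg hd fun s => (hp s).le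
  constructor
  · have hc : Continuous fun s => u s * Real.exp (-∫ t in Set.Ioi s, u t) :=
      hu.mul (continuous_iff_continuousAt.2 fun s => (hd s).continuousAt)
    rw [← pos_iff_ne_zero, lintegral_pos_iff_support hc.measurable.ennreal_ofReal]
    have : Function.support (fun s => ENNReal.ofReal
        (u s * Real.exp (-∫ t in Set.Ioi s, u t))) = Set.univ := by
      exact Set.eq_univ_of_forall fun s => (ENNReal.ofReal_pos.2 (hp s)).ne'
    rw [this]
    simp
  -- The integrand is the derivative of the monotone function `exp (-∫_s^∞ u)`, so its integral is
  -- the measure of the image, which lies in `[0,1]`.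
  · have h := lintegral_deriv_eq_volume_image_of_monotoneOn MeasurableSet.univ
      (fun s _ => (hd s).hasDerivWithinAt) (hmono.monotoneOn _)
    rw [Measure.restrict_univ] at h
    rw [h]
    refine (lt_of_le_of_lt (measure_mono (t := Set.Icc 0 1) ?_) (by simp)).ne
    rintro _ ⟨s, -, rfl⟩
    exact ⟨(Real.exp_pos _).le, Real.exp_le_one_iff.2 (neg_nonpos.2 (hge s))⟩

/-- A flow which contracts the measure at a constant exponential rate admits an integrable function
with orbit integrals equal to one. -/
theorem exists_lintegral_orbit_eq_one_of_contracting [TopologicalSpace V] [BorelSpace V]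
    [SFinite ν] {S : ℝ → V → V} (hSc : ∀ x, Continuous fun t => S t x)
    (hS : Measurable fun p : ℝ × V => S p.1 p.2)
    (hadd : ∀ s t x, S (s + t) x = S s (S t x)) {τ : ℝ} (hτ : 0 < τ)
    (hν : ∀ t (f : V → ℝ≥0∞), Measurable f →
      ∫⁻ x, f (S t x) ∂ν = ENNReal.ofReal (Real.exp (-(τ * t))) * ∫⁻ x, f x ∂ν)
    {w : V → ℝ} (hw : Continuous w) (hwpos : ∀ x, 0 < w x) (hwi : Integrable w ν) :
    ∃ F : V → ℝ≥0∞, Measurable F ∧ (∀ x, F x ≠ ⊤) ∧ ∫⁻ x, F x ∂ν ≠ ⊤ ∧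
      ∀ᵐ x ∂ν, ∫⁻ t, F (S t x) = 1 := by
  have hwm : Measurable fun x => ENNReal.ofReal (w x) := hw.measurable.ennreal_ofReal
  have hwS : Measurable fun p : ℝ × V => ENNReal.ofReal (w (S p.1 p.2)) := hwm.comp hS
  set Ψ : V → ℝ≥0∞ := fun x => ∫⁻ t in Set.Ioi 0, ENNReal.ofReal (w (S t x)) with hΨ
  have hΨm : Measurable Ψ := Measurable.lintegral_prod_left' hwS
  have hΨi : ∫⁻ x, Ψ x ∂ν ≠ ⊤ := by
    rw [hΨ, lintegral_lintegral_swap (f := fun x t => ENNReal.ofReal (w (S t x)))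
      (hwS.comp measurable_swap).aemeasurable]
    have h1 : ∀ t, ∫⁻ x, ENNReal.ofReal (w (S t x)) ∂ν =
        ENNReal.ofReal (Real.exp (-(τ * t))) * ∫⁻ x, ENNReal.ofReal (w x) ∂ν :=
      fun t => hν t _ hwm
    simp only [h1]
    rw [lintegral_mul_const _ (by fun_prop)]
    refine ENNReal.mul_ne_top ?_ ?_
    · have h2 := (integrableOn_exp_mul_Ioi (neg_lt_zero.2 hτ) 0).lintegral_lt_top
      simpa only [neg_mul] using h2.ne
    · exact hwi.lintegral_lt_top.ne
  have hΨae : ∀ᵐ x ∂ν, Ψ x < ⊤ := ae_lt_top hΨm hΨi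
  -- The orbit integral of `w` may diverge in backward time. The factor `e^{-Ψ}` damps it there, and
  -- `f ≤ w` stays integrable.
  set f : V → ℝ≥0∞ := fun x => ENNReal.ofReal (w x * Real.exp (-(Ψ x).toReal)) with hf
  have hfm : Measurable f :=
    (hw.measurable.mul (Real.measurable_exp.comp hΨm.ennreal_toReal.neg)).ennreal_ofReal
  refine exists_lintegral_orbit_eq_one_of_pos hS hadd hτ hν hfm (fun x => ENNReal.ofReal_ne_top)
    ?_ ?_
  · refine (lt_of_le_of_lt (lintegral_mono fun x => ?_) hwi.lintegral_lt_top).ne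
    refine ENNReal.ofReal_le_ofReal (mul_le_of_le_one_right (hwpos x).le ?_)
    exact Real.exp_le_one_iff.2 (neg_nonpos.2 ENNReal.toReal_nonneg)
  · filter_upwards [hΨae] with x hx
    have huc : Continuous fun t => w (S t x) := hw.comp (hSc x)
    have hi : IntegrableOn (fun t => w (S t x)) (Set.Ioi 0) := by
      refine ⟨huc.aestronglyMeasurable, ?_⟩
      rw [hasFiniteIntegral_iff_ofReal (ae_of_all _ fun t => (hwpos _).le)]
      exact hx
    have hΨS : ∀ s, (Ψ (S s x)).toReal = ∫ t in Set.Ioi s, w (S t x) := by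
      intro s
      rw [integral_eq_lintegral_of_nonneg_ae (ae_of_all _ fun t => (hwpos _).le)
        huc.aestronglyMeasurable]
      congr 1
      simp only [hΨ, ← hadd]
      have h := (measurePreserving_add_right volume s).setLIntegral_comp_preimage
        (measurableSet_Ioi (a := s)) (f := fun t => ENNReal.ofReal (w (S t x)))
        huc.measurable.ennreal_ofReal
      rw [← h]
      congr 2
      ext t
      simp
    have h := lintegral_mul_exp_neg_integral_Ioi huc (fun t => hwpos _) hi
    simpa only [hf, hΨS] using h

theorem exists_lintegral_orbit_eq_one [TopologicalSpace V] [BorelSpace V]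
    [SFinite ν] {S : ℝ → V → V} (hSc : ∀ x, Continuous fun t => S t x)
    (hS : Measurable fun p : ℝ × V => S p.1 p.2)
    (hadd : ∀ s t x, S (s + t) x = S s (S t x)) {τ : ℝ} (hτ : τ ≠ 0)
    (hν : ∀ t (f : V → ℝ≥0∞), Measurable f →
      ∫⁻ x, f (S t x) ∂ν = ENNReal.ofReal (Real.exp (-(τ * t))) * ∫⁻ x, f x ∂ν)
    {w : V → ℝ} (hw : Continuous w) (hwpos : ∀ x, 0 < w x) (hwi : Integrable w ν) :
    ∃ F : V → ℝ≥0∞, Measurable F ∧ (∀ x, F x ≠ ⊤) ∧ ∫⁻ x, F x ∂ν ≠ ⊤ ∧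
      ∀ᵐ x ∂ν, ∫⁻ t, F (S t x) = 1 := by
  rcases lt_or_gt_of_ne hτ with h | h
  · have h0 : Measurable fun p : ℝ × V => (-p.1, p.2) := measurable_fst.neg.prodMk measurable_snd
    obtain ⟨F, h1, h2, h3, h4⟩ := exists_lintegral_orbit_eq_one_of_contracting
      (S := fun t => S (-t)) (fun x => (hSc x).comp continuous_neg) (hS.comp h0)
      (fun s t x => by rw [neg_add, hadd]) (neg_pos.2 h)
      (fun t f hf => by rw [hν _ f hf]; simp) hw hwpos hwi
    refine ⟨F, h1, h2, h3, ?_⟩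
    filter_upwards [h4] with x hx
    rwa [lintegral_neg_eq_self (fun t => F (S t x))] at hx
  · exact exists_lintegral_orbit_eq_one_of_contracting hSc hS hadd h hν hw hwpos hwi

end Flow

/-! ### The one-parameter group and the two directions of the theorem -/

section OneParameter

open Matrix.GeneralLinearGroup

theorem Continuous.comp_fst {α β γ δ : Type*} [TopologicalSpace α] [TopologicalSpace β]
    [TopologicalSpace γ] [TopologicalSpace δ] {g : β × γ → δ} (hg : Continuous g) {c : α → β}
    (hc : Continuous c) : Continuous fun p : α × γ => g (c p.1, p.2) :=
  hg.comp ((hc.comp continuous_fst).prodMk continuous_snd)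

theorem measurable_comp_transposeEquiv {n : ℕ} (G : Subgroup (GL (Fin n) ℝ)) [MeasurableSpace G]
    [BorelSpace G] {F : EuclideanSpace ℝ (Fin n) → ℝ≥0∞} (hF : Measurable F)
    (ξ : EuclideanSpace ℝ (Fin n)) :
    Measurable fun a : G => F (transposeEquiv (a : GL (Fin n) ℝ) ξ) := by
  have hFT : Measurable fun p : G × EuclideanSpace ℝ (Fin n) =>
      F (transposeEquiv (p.1 : GL (Fin n) ℝ) p.2) := hF.comp (measurable_transposeEquiv _)
  exact hFT.comp (measurable_prodMk_right (y := ξ))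

theorem Matrix.continuous_exp_smul {n : ℕ} (X : Matrix (Fin n) (Fin n) ℝ) :
    Continuous fun t : ℝ => NormedSpace.exp (t • X) := by
  let : NormedRing (Matrix (Fin n) (Fin n) ℝ) := Matrix.linftyOpNormedRing
  let : NormedAlgebra ℝ (Matrix (Fin n) (Fin n) ℝ) := Matrix.linftyOpNormedAlgebra
  let : NormedAlgebra ℚ (Matrix (Fin n) (Fin n) ℝ) := .restrictScalars ℚ ℝ _
  exact NormedSpace.exp_continuous.comp (continuous_id.smul continuous_const)

theorem Matrix.hasDerivAt_exp_smul_apply {n : ℕ} (X : Matrix (Fin n) (Fin n) ℝ) (t : ℝ)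
    (i j : Fin n) :
    HasDerivAt (fun t : ℝ => NormedSpace.exp (t • X) i j) ((X * NormedSpace.exp (t • X)) i j) t := by
  let : NormedRing (Matrix (Fin n) (Fin n) ℝ) := Matrix.linftyOpNormedRing
  let : NormedAlgebra ℝ (Matrix (Fin n) (Fin n) ℝ) := Matrix.linftyOpNormedAlgebra
  have h := hasDerivAt_exp_smul_const' (𝕂 := ℝ) X t
  exact ((LinearMap.toContinuousLinearMap (Matrix.entryLinearMap ℝ ℝ i j)).hasFDerivAt
    (x := NormedSpace.exp (t • X))).comp_hasDerivAt t h

/-- Liouville's formula for `2 × 2` matrices. -/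
theorem Matrix.det_exp_smul_fin_two (X : Matrix (Fin 2) (Fin 2) ℝ) (t : ℝ) :
    (NormedSpace.exp (t • X)).det = Real.exp (X.trace * t) := by
  have hd : ∀ t, HasDerivAt (fun t : ℝ => (NormedSpace.exp (t • X)).det *
      Real.exp (-(X.trace * t))) 0 t := by
    intro t
    have h := fun i j => Matrix.hasDerivAt_exp_smul_apply X t i j
    have h1 := (((h 0 0).mul (h 1 1)).sub ((h 0 1).mul (h 1 0))).mul
      (((hasDerivAt_id t).const_mul X.trace).neg.exp)
    simp only [Matrix.det_fin_two]
    refine h1.congr_deriv ?_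
    simp only [Matrix.mul_apply, Fin.sum_univ_two, Matrix.trace_fin_two, Pi.mul_apply,
      Pi.sub_apply, Pi.neg_apply, id]
    ring
  have h := is_const_of_deriv_eq_zero (fun t => (hd t).differentiableAt) (fun t => (hd t).deriv) t 0
  simp only [zero_smul, NormedSpace.exp_zero, Matrix.det_one, mul_zero, neg_zero, Real.exp_zero,
    mul_one] at h
  rw [Real.exp_neg, mul_inv_eq_one₀ (Real.exp_pos _).ne'] at h
  exact h

variable {n : ℕ} (X : Matrix (Fin n) (Fin n) ℝ)

/-- The parametrization `t ↦ e^{tX}` of the one-parameter group. -/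
noncomputable def oneParameterGroup.param (t : ℝ) : oneParameterGroup X :=
  ⟨⟨NormedSpace.exp (t • X), NormedSpace.exp ((-t) • X), by
      rw [← Matrix.exp_add_of_commute _ _ (((Commute.refl X).smul_left t).smul_right (-t)),
        ← add_smul]
      simp, by
      rw [← Matrix.exp_add_of_commute _ _ (((Commute.refl X).smul_left (-t)).smul_right t),
        ← add_smul]
      simp⟩, t, rfl⟩

namespace oneParameterGroup

theorem coe_param (t : ℝ) : (((param X t : oneParameterGroup X) : GL (Fin n) ℝ) :
    Matrix (Fin n) (Fin n) ℝ) = NormedSpace.exp (t • X) := rfl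

theorem param_add (s t : ℝ) : param X (s + t) = param X s * param X t := by
  ext1
  ext1
  rw [Subgroup.coe_mul, Units.val_mul, coe_param, coe_param, coe_param, add_smul,
    Matrix.exp_add_of_commute _ _ (((Commute.refl X).smul_left s).smul_right t)]

theorem param_surjective : Function.Surjective (param X) := by
  rintro ⟨a, t, ht⟩
  refine ⟨t, ?_⟩
  ext1
  ext1
  exact ht.symm

theorem continuous_param : Continuous (param X) := by
  refine Continuous.subtype_mk (Units.continuous_iff.2 ⟨?_, ?_⟩) _
  · exact Matrix.continuous_exp_smul X
  · exact (Matrix.continuous_exp_smul X).comp continuous_neg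

theorem mul_comm (a b : oneParameterGroup X) : a * b = b * a := by
  obtain ⟨s, rfl⟩ := param_surjective X a
  obtain ⟨t, rfl⟩ := param_surjective X b
  rw [← param_add, ← param_add, add_comm]

theorem continuous_transposeEquiv_param : Continuous fun p : ℝ × EuclideanSpace ℝ (Fin n) =>
    transposeEquiv (param X p.1 : GL (Fin n) ℝ) p.2 := by
  have h1 : Continuous fun t => (param X t : GL (Fin n) ℝ) :=
    continuous_subtype_val.comp (continuous_param X)
  exact continuous_transposeEquiv.comp_fst h1

/-- This makes a Haar measure on the group σ-finite, as Tonelli and uniqueness of invariant measures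
require. -/
theorem sigmaCompactSpace : SigmaCompactSpace (oneParameterGroup X) := by
  rw [← isSigmaCompact_univ_iff, ← (param_surjective X).range_eq]
  exact isSigmaCompact_range (continuous_param X)

end oneParameterGroup

open oneParameterGroup

theorem not_isAdmissible_of_trace_eq_zero (X : Matrix (Fin 2) (Fin 2) ℝ) (hX : X.trace = 0) :
    ¬ IsAdmissible (oneParameterGroup X) := by
  let : MeasurableSpace (oneParameterGroup X) := borel _
  rintro ⟨μ, hμ, ψ, hψ⟩
  have : BorelSpace (oneParameterGroup X) := ⟨rfl⟩
  have := sigmaCompactSpace X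
  obtain ⟨F, hF, hFi, h1⟩ := hψ.exists_lintegral_eq_one
  refine hFi (lintegral_eq_top_of_abs_det_eq_one _ (mul_comm X) (fun a ha => ?_) hF h1)
  obtain ⟨t, ht⟩ := ha
  rw [ht, Matrix.det_exp_smul_fin_two, hX]
  simp

/-- The trace matters only for finiteness on compact sets: `log det` recovers `t · tr X`
continuously, so preimages of compact sets are bounded. For rotations the parametrization is
periodic and this fails. -/
theorem isHaarMeasure_map_param (X : Matrix (Fin 2) (Fin 2) ℝ) (hX : X.trace ≠ 0)
    [MeasurableSpace (oneParameterGroup X)] [BorelSpace (oneParameterGroup X)] :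
    (Measure.map (param X) volume).IsHaarMeasure := by
  have hc := continuous_param X
  refine { lt_top_of_isCompact := ?_, map_mul_left_eq_self := ?_, open_pos := ?_ }
  · intro K hK
    rw [Measure.map_apply hc.measurable hK.isClosed.measurableSet]
    have hd : Continuous fun a : oneParameterGroup X =>
        Real.log ((a : GL (Fin 2) ℝ) : Matrix (Fin 2) (Fin 2) ℝ).det := by
      have h1 : Continuous fun a : oneParameterGroup X =>
        ((a : GL (Fin 2) ℝ) : Matrix (Fin 2) (Fin 2) ℝ).det :=
        (Units.continuous_val.comp continuous_subtype_val).matrix_det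
      refine h1.log fun a => ?_
      exact ((Matrix.isUnit_iff_isUnit_det _).1 (a : GL (Fin 2) ℝ).isUnit).ne_zero
    obtain ⟨C, hC⟩ := (hK.image hd).isBounded.exists_norm_le
    have hsub : param X ⁻¹' K ⊆ Metric.closedBall 0 (C / |X.trace|) := by
      intro t ht
      have h2 := hC _ ⟨_, ht, rfl⟩
      beta_reduce at h2
      rw [coe_param, Matrix.det_exp_smul_fin_two, Real.log_exp, norm_mul, Real.norm_eq_abs,
        Real.norm_eq_abs] at h2
      rw [mem_closedBall_zero_iff, Real.norm_eq_abs, le_div_iff₀ (abs_pos.2 hX), _root_.mul_comm]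
      exact h2
    exact (measure_mono hsub).trans_lt (isCompact_closedBall _ _).measure_lt_top
  · intro g
    obtain ⟨s, rfl⟩ := param_surjective X g
    have hm : Measurable fun x : oneParameterGroup X => param X s * x :=
      (continuous_const.mul continuous_id).measurable
    rw [Measure.map_map hm hc.measurable]
    have h2 : (fun x : oneParameterGroup X => param X s * x) ∘ param X =
        param X ∘ fun t => s + t := by
      ext1 t
      simp only [Function.comp_apply, param_add]
    rw [h2, ← Measure.map_map hc.measurable (measurable_const_add s), map_add_left_eq_self]
  · intro U hU hne
    rw [Measure.map_apply hc.measurable hU.measurableSet]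
    exact (hU.preimage hc).measure_ne_zero _ (hne.preimage (param_surjective X))

theorem isAdmissible_of_trace_ne_zero (X : Matrix (Fin 2) (Fin 2) ℝ) (hX : X.trace ≠ 0) :
    IsAdmissible (oneParameterGroup X) := by
  let : MeasurableSpace (oneParameterGroup X) := borel _
  have : BorelSpace (oneParameterGroup X) := ⟨rfl⟩
  refine ⟨Measure.map (param X) volume, isHaarMeasure_map_param X hX, ?_⟩
  have hS : Continuous fun p : ℝ × EuclideanSpace ℝ (Fin 2) =>
      transposeEquiv (param X p.1 : GL (Fin 2) ℝ) p.2 := by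
    exact continuous_transposeEquiv_param X
  obtain ⟨F, hF, hFtop, hFi, h1⟩ := exists_lintegral_orbit_eq_one
    (ν := (volume : Measure (EuclideanSpace ℝ (Fin 2))))
    (S := fun t x => transposeEquiv (param X t : GL (Fin 2) ℝ) x)
    (fun x => hS.comp (Continuous.prodMk_left x)) hS.measurable
    -- Transposition reverses products; commutativity of addition restores the order.
    (fun s t x => by rw [add_comm, param_add, Subgroup.coe_mul, transposeEquiv_mul]) hX
    (fun t f hf => by
      rw [lintegral_comp_continuousLinearEquiv, det_transposeEquiv, coe_param,
        Matrix.det_exp_smul_fin_two, abs_of_pos (Real.exp_pos _), Real.exp_neg])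
    -- The decay exponent `3` exceeds the dimension `2`, which gives integrability.
    (w := fun x => (1 + ‖x‖) ^ (-3 : ℝ))
    ((continuous_const.add continuous_norm).rpow_const fun x =>
      Or.inl (add_pos_of_pos_of_nonneg one_pos (norm_nonneg x)).ne')
    (fun x => by positivity)
    (integrable_one_add_norm (by simp; norm_num))
  refine exists_isContinuousWavelet _ hF hFtop hFi ?_
  filter_upwards [h1] with ξ hξ
  rw [lintegral_map (measurable_comp_transposeEquiv _ hF ξ) (continuous_param X).measurable]
  exact hξ

end OneParameter

theorem mainTheorem2 (X : Matrix (Fin 2) (Fin 2) ℝ) :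
    IsAdmissible (oneParameterGroup X) ↔ X.trace ≠ 0 :=
  ⟨fun h hX => not_isAdmissible_of_trace_eq_zero X hX h, isAdmissible_of_trace_ne_zero X⟩
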